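/- Write $\mathbb C^3=\mathbb R^3+i\mathbb R^3$ with coordinates $z_a=x_a+iy_a$, let $B^3\subset\mathbb R^3$ be the unit ball, and let $Z=B^3\times T^3\subset\mathbb C^3/i\mathbb Z^3$ with $T^3=i\mathbb R^3/i\mathbb Z^3$, so that $M=\partial Z=S^2\times T^3$. Let $\psi+i\tilde\psi=i\,dz_1\wedge dz_2\wedge dz_3$. On $M$ take the contact form $\theta=\sum_a x_a\,dy_a$, with Reeb field $v=\sum_a x_a\,\partial/\partial y_a$ and contact distribution $H=\ker\theta$. Let $\Lambda^p_H$ be the bundle of $p$-forms $\zeta$ on $M$ with $v\lrcorner\zeta=0$, so that $\Lambda^pT^*M=\theta\wedge\Lambda^{p-1}_H\oplus\Lambda^p_H$, and for $\sigma\in\Gamma(\Lambda^p_H)$ let $d_H\sigma$ be the component of $d\sigma$ in $\Lambda^{p+1}_H$. Put $\omega=d\theta$ and let $\alpha,\beta$ be the sections of $\Lambda^2_H$ with $\psi|_M=\alpha\wedge\theta$ and $\tilde\psi|_M=\beta\wedge\theta$. The self-dual forms are $\Lambda^+_H=\mathrm{span}(\omega,\alpha,\beta)$, and $\Lambda^-_H\subset\Lambda^2_H$,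 the bundle of anti-self-dual forms, consists of the $\sigma$ with $\sigma\wedge\omega=\sigma\wedge\alpha=\sigma\wedge\beta=0$. Let $\Omega^-_H$ be the space of smooth real sections of $\Lambda^-_H$ over $M$, and $$\mathcal H_M=\{\sigma\in\Omega^-_H:\ d_H\sigma=0\}.$$ Proposition. The real vector space $\mathcal H_M$ is one-dimensional, spanned by (the restriction to $M$ of) $$\gamma=\sum_{(i,j,k)\ \mathrm{cyclic}}x_i\,(dx_j\wedge dx_k+dy_j\wedge dy_k),$$ the sum being over the cyclic permutations of $(1,2,3)$; moreover the pull-back of $\gamma$ to the cover $S^2\times i\mathbb R^3$ is invariant under the diagonal action $(x,y)\mapsto(Rx,Ry)$ of $SO(3)$. -/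

import Mathlib

open scoped ContDiff Nat

noncomputable section

namespace CYBoundary

/-! ## Exterior algebra -/

section Algebra

variable {F : Type*} [NormedAddCommGroup F] [NormedSpace ℝ F]
variable {A : Type*} [NormedCommRing A] [NormedAlgebra ℝ A]

/-- The multilinear map `(v₁, …, v_{k+l}) ↦ a (v₁, …, v_k) * b (v_{k+1}, …, v_{k+l})`. -/
def tensorMul {k l : ℕ} (a : F [⋀^Fin k]→L[ℝ] A) (b : F [⋀^Fin l]→L[ℝ] A) :
    ContinuousMultilinearMap ℝ (fun _ : Fin (k + l) => F) A where
  toMultilinearMap := (LinearMap.mul' ℝ A).compMultilinearMap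
    ((a.toMultilinearMap.domCoprod b.toMultilinearMap).domDomCongr finSumFinEquiv)
  cont := by
    have h : Continuous fun v : Fin (k + l) → F =>
        a (fun i => v (Fin.castAdd l i)) * b (fun i => v (Fin.natAdd k i)) :=
      (a.cont.comp (by fun_prop)).mul (b.cont.comp (by fun_prop))
    exact h

theorem tensorMul_apply {k l : ℕ} (a : F [⋀^Fin k]→L[ℝ] A) (b : F [⋀^Fin l]→L[ℝ] A)
    (v : Fin (k + l) → F) :
    tensorMul a b v = a (fun i => v (Fin.castAdd l i)) * b (fun i => v (Fin.natAdd k i)) := rfl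

/-- The wedge product of alternating forms:
`(a ∧ b) (v) = (1 / (k! l!)) ∑_s sgn(s) a (v_{s 1}, …, v_{s k}) b (v_{s (k+1)}, …, v_{s (k+l)})`,
so that `(f₁ ∧ ⋯ ∧ f_n) (v) = det (f_i (v_j))` for linear forms. -/
def wedge {k l : ℕ} (a : F [⋀^Fin k]→L[ℝ] A) (b : F [⋀^Fin l]→L[ℝ] A) :
    F [⋀^Fin (k + l)]→L[ℝ] A :=
  ((k ! * l ! : ℝ)⁻¹) • ContinuousMultilinearMap.alternatization (tensorMul a b)

theorem wedge_apply {k l : ℕ} (a : F [⋀^Fin k]→L[ℝ] A) (b : F [⋀^Fin l]→L[ℝ] A)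
    (v : Fin (k + l) → F) :
    wedge a b v = ((k ! * l ! : ℝ)⁻¹) • ∑ s : Equiv.Perm (Fin (k + l)),
      Equiv.Perm.sign s • (a (fun i => v (s (Fin.castAdd l i))) *
        b (fun i => v (s (Fin.natAdd k i)))) := by
  simp only [wedge, ContinuousAlternatingMap.smul_apply,
    ContinuousMultilinearMap.alternatization_apply_apply]
  rfl

theorem wedge_add_left {k l : ℕ} (a a' : F [⋀^Fin k]→L[ℝ] A) (b : F [⋀^Fin l]→L[ℝ] A) :
    wedge (a + a') b = wedge a b + wedge a' b := by
  ext v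
  simp only [wedge_apply, ContinuousAlternatingMap.add_apply, add_mul, smul_add,
    Finset.sum_add_distrib]

theorem wedge_smul_left {k l : ℕ} (c : ℝ) (a : F [⋀^Fin k]→L[ℝ] A) (b : F [⋀^Fin l]→L[ℝ] A) :
    wedge (c • a) b = c • wedge a b := by
  ext v
  simp only [wedge_apply, ContinuousAlternatingMap.smul_apply, smul_mul_assoc, Finset.smul_sum]
  refine Finset.sum_congr rfl fun s _ => ?_
  rw [smul_comm (Equiv.Perm.sign s) c, smul_comm c (((k ! : ℝ) * (l ! : ℝ))⁻¹)]

/-- A linear form regarded as an alternating form of degree one. -/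
def oneForm (f : F →L[ℝ] A) : F [⋀^Fin 1]→L[ℝ] A :=
  ContinuousAlternatingMap.ofSubsingleton ℝ F A 0 f

end Algebra

/-! ## The ambient space `ℂ³ = ℝ³ + iℝ³` -/

abbrev V : Type := EuclideanSpace ℝ (Fin 3)

/-- `ℂ³ = ℝ³ + iℝ³`; the pair `(x, y)` stands for `z = x + iy`. -/
abbrev E : Type := V × V

def dx (i : Fin 3) : E →L[ℝ] ℝ :=
  (EuclideanSpace.proj i : V →L[ℝ] ℝ).comp (ContinuousLinearMap.fst ℝ V V)

def dy (i : Fin 3) : E →L[ℝ] ℝ :=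
  (EuclideanSpace.proj i : V →L[ℝ] ℝ).comp (ContinuousLinearMap.snd ℝ V V)

def dz (i : Fin 3) : E →L[ℝ] ℂ :=
  Complex.ofRealCLM.comp (dx i) + Complex.I • Complex.ofRealCLM.comp (dy i)

/-- The holomorphic 3-form `i dz₁ ∧ dz₂ ∧ dz₃`. -/
def holForm : E [⋀^Fin 3]→L[ℝ] ℂ :=
  Complex.I • wedge (wedge (oneForm (dz 0)) (oneForm (dz 1))) (oneForm (dz 2))

/-- `ψ = Re (i dz₁ ∧ dz₂ ∧ dz₃)`. -/
def psi : E [⋀^Fin 3]→L[ℝ] ℝ := Complex.reCLM.compContinuousAlternatingMap holForm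

/-- `ψ̃ = Im (i dz₁ ∧ dz₂ ∧ dz₃)`. -/
def psiTilde : E [⋀^Fin 3]→L[ℝ] ℝ := Complex.imCLM.compContinuousAlternatingMap holForm

/-! ## The boundary `M = S² × T³` and differential forms on it -/

abbrev Sph : Type := Metric.sphere (0 : V) 1

/-- The boundary `S² × T³` of `B³ × T³ ⊂ ℂ³ / iℤ³`, where `T³ = iℝ³ / iℤ³ = (ℝ/ℤ)³`. -/
abbrev M : Type := Sph × UnitAddTorus (Fin 3)

/-- The tangent space `T_{(x,t)} M = x^⊥ ⊕ ℝ³`. -/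
abbrev TM (p : M) : Type := ↥((ℝ ∙ (p.1 : V))ᗮ) × V

/-- The inclusion of the tangent space of `M` into that of `ℂ³ / iℤ³`. -/
def incl (p : M) : TM p →L[ℝ] E :=
  ((ℝ ∙ (p.1 : V))ᗮ).subtypeL.prodMap (ContinuousLinearMap.id ℝ V)

/-- Fields of alternating `k`-forms on `M` (no regularity is imposed here). -/
abbrev Form (k : ℕ) : Type := (p : M) → TM p [⋀^Fin k]→L[ℝ] ℝ

/-- The restriction to `M` of a translation-invariant form on `(ℝ³ × iℝ³) / iℤ³`. -/
def restr {k : ℕ} (η : V → E [⋀^Fin k]→L[ℝ] ℝ) : Form k :=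
  fun p => (η p.1).compContinuousLinearMap (incl p)

/-- The projection `π(x, y) = (x / |x|, t + [y])` of `(ℝ³ ∖ 0) × ℝ³` to `S² × T³`. -/
def proj (t : UnitAddTorus (Fin 3)) (q : E) (hq : q.1 ≠ 0) : M :=
  (⟨‖q.1‖⁻¹ • q.1, by
      rw [mem_sphere_zero_iff_norm, norm_smul, norm_inv, norm_norm,
        inv_mul_cancel₀ (norm_ne_zero_iff.mpr hq)]⟩,
    fun i => t i + ((q.2 i : ℝ) : UnitAddCircle))

/-- The derivative `(a, b) ↦ (|x|⁻¹ (a - ⟨a, x/|x|⟩ x/|x|), b)` of the projection `proj t`. -/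
def projDeriv (t : UnitAddTorus (Fin 3)) (q : E) (hq : q.1 ≠ 0) :
    E →L[ℝ] TM (proj t q hq) :=
  (‖q.1‖⁻¹ • ((ℝ ∙ ((proj t q hq).1 : V))ᗮ).orthogonalProjectionOnto).prodMap
    (ContinuousLinearMap.id ℝ V)

open Classical in
/-- The pull-back of a form on `M` under the submersion `proj t : (ℝ³ ∖ 0) × ℝ³ → S² × T³`,
extended by zero to `ℝ³ × ℝ³`. -/
def pull {k : ℕ} (σ : Form k) (t : UnitAddTorus (Fin 3)) (q : E) : E [⋀^Fin k]→L[ℝ] ℝ :=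
  if hq : q.1 ≠ 0 then (σ (proj t q hq)).compContinuousLinearMap (projDeriv t q hq) else 0

/-- A form on `M` is smooth iff its pull-backs under the smooth surjective submersions `proj t`
are smooth (for one base point `t` or, equivalently, for all of them). -/
def IsSmooth {k : ℕ} (σ : Form k) : Prop :=
  ∀ t, ContDiffOn ℝ ∞ (pull σ t) {q : E | q.1 ≠ 0}

/-- The exterior derivative on `M`. The map `proj t` restricts to a local diffeomorphism
`S² × ℝ³ → M`, `(x', y') ↦ (x', t + [y'])`, with `(x, 0) ↦ (x, t)`, whose derivative at `(x, 0)`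
is the identity of `x^⊥ ⊕ ℝ³`. As `d` commutes with pull-backs, `dσ` at `(x, t)` is the restriction
to `x^⊥ ⊕ ℝ³` of the exterior derivative at `(x, 0)` of the pull-back of `σ` under `proj t`. -/
def extD {k : ℕ} (σ : Form k) : Form (k + 1) :=
  fun p => (extDeriv (pull σ p.2) ((p.1 : V), 0)).compContinuousLinearMap (incl p)

/-! ## The contact structure induced by the holomorphic 3-form -/

/-- The contact form `θ = ∑ xᵢ dyᵢ`, as a linear form on the tangent space. -/
def thetaL (p : M) : TM p →L[ℝ] ℝ := (∑ i : Fin 3, (p.1 : V) i • dy i).comp (incl p)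

def theta : Form 1 := fun p => oneForm (thetaL p)

/-- The Reeb field `v = ∑ xᵢ ∂/∂yᵢ`. -/
def reeb (p : M) : TM p := (0, (p.1 : V))

/-- Interior product with the Reeb field. -/
def contractReeb {k : ℕ} (σ : Form (k + 1)) : Form k := fun p => (σ p).curryLeft (reeb p)

/-- Sections of `Λ_H^p`, the forms whose interior product with the Reeb field is zero. -/
def IsHorizontal {k : ℕ} (σ : Form (k + 1)) : Prop := contractReeb σ = 0

/-- The projection `TM → H = ker θ` along the Reeb field. -/
def projH (p : M) : TM p →L[ℝ] TM p :=
  ContinuousLinearMap.id ℝ (TM p) - (thetaL p).smulRight (reeb p)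

/-- The component in `Λ_H` of a form, for `Λ^k T^*M = θ ∧ Λ_H^{k-1} ⊕ Λ_H^k`. -/
def horPart {k : ℕ} (σ : Form k) : Form k := fun p => (σ p).compContinuousLinearMap (projH p)

/-- `d_H`, the projection of the exterior derivative to `H`. -/
def dH {k : ℕ} (σ : Form k) : Form (k + 1) := horPart (extD σ)

def omega : Form 2 := extD theta

/-- The 2-form `α` on `H` with `ψ|_M = α ∧ θ`. -/
def alpha : Form 2 := contractReeb (restr fun _ => psi)

/-- The 2-form `β` on `H` with `ψ̃|_M = β ∧ θ`. -/
def beta : Form 2 := contractReeb (restr fun _ => psiTilde)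

/-- Pointwise orthogonality, for the wedge pairing on `Λ²_H`, to `Λ⁺_H = span (ω, α, β)`. -/
def IsAntiSelfDual (σ : Form 2) : Prop :=
  ∀ p, wedge (σ p) (omega p) = 0 ∧ wedge (σ p) (alpha p) = 0 ∧ wedge (σ p) (beta p) = 0

/-! ### Linearity -/

theorem pull_of_ne {k : ℕ} (σ : Form k) (t) {q : E} (hq : q.1 ≠ 0) :
    pull σ t q = (σ (proj t q hq)).compContinuousLinearMap (projDeriv t q hq) := dif_pos hq

theorem pull_add {k : ℕ} (σ τ : Form k) (t) : pull (σ + τ) t = pull σ t + pull τ t := by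
  funext q
  by_cases hq : q.1 ≠ 0
  · rw [Pi.add_apply, pull_of_ne _ t hq]
    simp only [pull_of_ne _ t hq]
    rfl
  · simp [pull, hq]

theorem pull_smul {k : ℕ} (c : ℝ) (σ : Form k) (t) : pull (c • σ) t = c • pull σ t := by
  funext q
  by_cases hq : q.1 ≠ 0
  · rw [Pi.smul_apply, pull_of_ne _ t hq]
    simp only [pull_of_ne _ t hq]
    rfl
  · simp [pull, hq]

theorem pull_zero {k : ℕ} (t) : pull (0 : Form k) t = 0 := by
  simpa using pull_smul (0 : ℝ) (0 : Form k) t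

theorem IsSmooth.differentiableAt {k : ℕ} {σ : Form k} (h : IsSmooth σ) (p : M) :
    DifferentiableAt ℝ (pull σ p.2) ((p.1 : V), 0) := by
  have ho : IsOpen {q : E | q.1 ≠ 0} := isOpen_ne_fun continuous_fst continuous_const
  refine ((h p.2).contDiffAt (ho.mem_nhds ?_)).differentiableAt (by simp)
  exact ne_zero_of_mem_unit_sphere p.1

theorem dH_add {k : ℕ} {σ τ : Form k} (hσ : IsSmooth σ) (hτ : IsSmooth τ) :
    dH (σ + τ) = dH σ + dH τ := by
  funext p
  simp only [dH, horPart, extD, Pi.add_apply, pull_add,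
    extDeriv_add (hσ.differentiableAt p) (hτ.differentiableAt p)]
  rfl

theorem dH_smul {k : ℕ} (c : ℝ) (σ : Form k) : dH (c • σ) = c • dH σ := by
  funext p
  simp only [dH, horPart, extD, Pi.smul_apply, pull_smul, extDeriv_smul]
  rfl

theorem dH_zero {k : ℕ} : dH (0 : Form k) = 0 := by
  simpa using dH_smul (0 : ℝ) (0 : Form k)

theorem contractReeb_add {k : ℕ} (σ τ : Form (k + 1)) :
    contractReeb (σ + τ) = contractReeb σ + contractReeb τ := rfl

theorem contractReeb_smul {k : ℕ} (c : ℝ) (σ : Form (k + 1)) :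
    contractReeb (c • σ) = c • contractReeb σ := rfl

theorem IsSmooth.add {k : ℕ} {σ τ : Form k} (hσ : IsSmooth σ) (hτ : IsSmooth τ) :
    IsSmooth (σ + τ) := fun t => by
  rw [pull_add]
  exact (hσ t).add (hτ t)

theorem IsSmooth.smul {k : ℕ} (c : ℝ) {σ : Form k} (hσ : IsSmooth σ) : IsSmooth (c • σ) :=
  fun t => by
    rw [pull_smul]
    exact (hσ t).const_smul c

theorem IsSmooth.zero {k : ℕ} : IsSmooth (0 : Form k) := fun t => by
  rw [pull_zero]
  exact contDiffOn_const

/-! ## The space `ℋ_M` -/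

/-- `Ω⁻_H`, the smooth anti-self-dual 2-forms on the contact distribution. -/
def OmegaMinus : Submodule ℝ (Form 2) where
  carrier := {σ | IsSmooth σ ∧ IsHorizontal σ ∧ IsAntiSelfDual σ}
  zero_mem' := by
    refine ⟨IsSmooth.zero, ?_, fun p => ?_⟩
    · simpa [IsHorizontal] using contractReeb_smul (0 : ℝ) (0 : Form 2)
    · have h (b : TM p [⋀^Fin 2]→L[ℝ] ℝ) : wedge (0 : TM p [⋀^Fin 2]→L[ℝ] ℝ) b = 0 := by
        simpa using wedge_smul_left (0 : ℝ) (0 : TM p [⋀^Fin 2]→L[ℝ] ℝ) b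
      exact ⟨h _, h _, h _⟩
  add_mem' := by
    rintro σ τ ⟨h₁, h₂, h₃⟩ ⟨k₁, k₂, k₃⟩
    refine ⟨h₁.add k₁, ?_, fun p => ?_⟩
    · rw [IsHorizontal, contractReeb_add, h₂, k₂, add_zero]
    · simp only [Pi.add_apply, wedge_add_left, h₃ p, k₃ p, add_zero, and_self]
  smul_mem' := by
    rintro c σ ⟨h₁, h₂, h₃⟩
    refine ⟨h₁.smul c, ?_, fun p => ?_⟩
    · rw [IsHorizontal, contractReeb_smul, h₂, smul_zero]
    · simp only [Pi.smul_apply, wedge_smul_left, h₃ p, smul_zero, and_self]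

/-- `ℋ_M = {σ ∈ Ω⁻_H : d_H σ = 0}`. -/
def HM : Submodule ℝ (Form 2) where
  carrier := {σ | σ ∈ OmegaMinus ∧ dH σ = 0}
  zero_mem' := ⟨OmegaMinus.zero_mem, dH_zero⟩
  add_mem' := by
    rintro σ τ ⟨h₁, h₂⟩ ⟨k₁, k₂⟩
    exact ⟨OmegaMinus.add_mem h₁ k₁, by rw [dH_add h₁.1 k₁.1, h₂, k₂, add_zero]⟩
  smul_mem' := by
    rintro c σ ⟨h₁, h₂⟩
    exact ⟨OmegaMinus.smul_mem c h₁, by rw [dH_smul, h₂, smul_zero]⟩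

/-- The form `γ = ∑_{(i,j,k) cyclic} xᵢ (dxⱼ ∧ dxₖ + dyⱼ ∧ dyₖ)` on `M`
(indices are taken modulo 3, so `j = i + 1` and `k = i + 2`). -/
def gamma : Form 2 := restr fun x => ∑ i : Fin 3, x i •
  (wedge (oneForm (dx (i + 1))) (oneForm (dx (i + 2))) +
    wedge (oneForm (dy (i + 1))) (oneForm (dy (i + 2))))

/-- The diagonal action `(x, y) ↦ (R x, R y)` of a linear isometry of `ℝ³` on `ℝ³ + iℝ³`. -/
def diagAct (R : V ≃ₗᵢ[ℝ] V) : E →L[ℝ] E :=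
  (R.toContinuousLinearEquiv : V →L[ℝ] V).prodMap (R.toContinuousLinearEquiv : V →L[ℝ] V)

/-- The pull-back of `σ` to the cover, as a form on `(ℝ³ ∖ 0) × ℝ³`, is invariant under the
diagonal action of `SO(3)`. As `(x, y) ↦ (x / |x|, y)` commutes with this action, this is
invariance of the pull-back to `S² × iℝ³`. -/
def IsSO3Invariant {k : ℕ} (σ : Form k) : Prop :=
  ∀ R : V ≃ₗᵢ[ℝ] V, LinearMap.det (R.toLinearEquiv : V →ₗ[ℝ] V) = 1 →
    ∀ q : E, q.1 ≠ 0 →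
      (pull σ 0 (diagAct R q)).compContinuousLinearMap (diagAct R) = pull σ 0 q

end CYBoundary

end

open scoped ContDiff Nat

noncomputable section

namespace CYBoundary

/-! ### Integrals and measure-preserving flows -/

open MeasureTheory

/-! Lift everything to the bundle O(3) × T³ of orthonormal frames (e₀, e₁, e₂), the rows of a
matrix, over the point x = e₂. At a frame, H has the basis A₀, A₁, B₀, B₁: the vectors e₀, e₁ taken
tangent to S² and to T³. Anti-self-duality leaves three components of σ (`asd_relations`): f =
σ(A₀,A₁) = σ(B₀,B₁), p = σ(A₀,B₀) = -σ(A₁,B₁) and r = σ(A₀,B₁) = σ(A₁,B₀). Let X₀, X₁ be the fields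
turning e₂ towards e₀, e₁, let Z turn e₀ towards e₁, and let W_a = e_a · ∂/∂y. Then d_H σ = 0
becomes W₀f = X₁p - X₀r, W₁f = X₀p + X₁r, X₀f = W₀r - W₁p, X₁f = -(W₀p + W₁r), while the change of
frame gives Zp = 2r, Zr = -2p (`isSystem_of_mem_HM`).

For a, b in {0, 1} one has [X_a, W_b] = -δ_ab W₂, so differentiating the system gives (X₀² + X₁² +
W₀² + W₁²)f = 0. The fields preserve a finite measure on the compact frame bundle; integration by
parts (`lieD_eq_zero_of_sum_sq`) therefore kills these four derivatives of f. Brackets give Zf = W₂f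
= 0, so f is constant on the frames joined to the standard one.

What remains is X₁p = X₀r, X₀p = -X₁r, a Cauchy-Riemann system on each sphere. With [X₀, X₁] = Z it
yields (X₀² + X₁²)p = 2p, and the same integration forces p = 0, hence r = Zp/2 = 0: there are no
trace-free divergence-free symmetric tensors on S².

Thus σ is determined by one value of f, which for γ is 1. Conversely γ lies in ℋ_M by pointwise
algebra: on H its differential is built from triple products of vectors of the plane x^⊥. -/

/-- The derivative of a function along a measure-preserving flow has integral zero. -/
theorem integral_flow_deriv_eq_zero {K : Type*} [TopologicalSpace K] [CompactSpace K]
    [MeasurableSpace K] [BorelSpace K] {μ : Measure K} [IsFiniteMeasure μ]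
    (Φ : ℝ → K → K) (hΦ : ∀ s, MeasurePreserving (Φ s) μ μ)
    {h h' : K → ℝ} (hc : Continuous h) (hc' : Continuous h') (h0 : ∀ k, Φ 0 k = k)
    (hd : ∀ k s, HasDerivAt (fun s => h (Φ s k)) (h' (Φ s k)) s) : ∫ k, h' k ∂μ = 0 := by
  obtain ⟨C, hC⟩ := isCompact_univ.exists_bound_of_continuousOn hc'.continuousOn
  have hm : ∀ s, AEStronglyMeasurable (fun k => h (Φ s k)) μ := fun s =>
    (hc.measurable.comp (hΦ s).measurable).aestronglyMeasurable
  have hm' : ∀ s, AEStronglyMeasurable (fun k => h' (Φ s k)) μ := fun s =>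
    (hc'.measurable.comp (hΦ s).measurable).aestronglyMeasurable
  have hi : Integrable h μ := by
    obtain ⟨D, hD⟩ := isCompact_univ.exists_bound_of_continuousOn hc.continuousOn
    exact Integrable.of_bound hc.measurable.aestronglyMeasurable D
      (Filter.Eventually.of_forall fun k => hD k (Set.mem_univ _))
  -- Differentiate ∫ h ∘ Φ_s under the integral sign; compactness bounds the derivative uniformly in
  -- s. The integral does not depend on s, since Φ_s preserves μ.
  have key := (hasDerivAt_integral_of_dominated_loc_of_deriv_le (μ := μ) (x₀ := (0 : ℝ))
    (F := fun s k => h (Φ s k)) (F' := fun s k => h' (Φ s k)) (bound := fun _ => C)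
    (s := Set.univ) Filter.univ_mem (Filter.Eventually.of_forall hm) (by simpa only [h0] using hi)
    (hm' 0) (Filter.Eventually.of_forall fun k s _ => hC _ (Set.mem_univ _))
    (integrable_const C) (Filter.Eventually.of_forall fun k s _ => hd k s)).2
  have hconst : ∀ s, ∫ k, h (Φ s k) ∂μ = ∫ k, h k ∂μ := fun s => by
    have := integral_map (μ := μ) (hΦ s).measurable.aemeasurable
      (f := h) hc.measurable.aestronglyMeasurable
    rw [(hΦ s).map_eq] at this
    exact this.symm
  simp only [hconst, h0] at key
  exact key.unique (hasDerivAt_const _ _)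

/-! ### Orthonormal frames -/

abbrev G : Type := Matrix.orthogonalGroup (Fin 3) ℝ

theorem isClosed_orthogonalGroup :
    IsClosed (Matrix.orthogonalGroup (Fin 3) ℝ : Set (Matrix (Fin 3) (Fin 3) ℝ)) := by
  have : (Matrix.orthogonalGroup (Fin 3) ℝ : Set (Matrix (Fin 3) (Fin 3) ℝ)) =
      {A | A * A.transpose = 1} := by
    ext A
    exact Matrix.mem_orthogonalGroup_iff _ _
  rw [this]
  exact isClosed_eq (by fun_prop) continuous_const

theorem orth_row (g : G) (i j : Fin 3) : ∑ k, g.1 i k * g.1 j k = if i = j then 1 else 0 := by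
  have := congrFun (congrFun ((Matrix.mem_orthogonalGroup_iff _ _).1 g.2) i) j
  simpa [Matrix.mul_apply, Matrix.one_apply] using this

theorem orth_col (g : G) (i j : Fin 3) : ∑ k, g.1 k i * g.1 k j = if i = j then 1 else 0 := by
  have := congrFun (congrFun ((Matrix.mem_orthogonalGroup_iff' _ _).1 g.2) i) j
  simpa [Matrix.mul_apply, Matrix.one_apply] using this

instance : CompactSpace G := by
  refine isCompact_iff_compactSpace.1 ?_
  refine IsCompact.of_isClosed_subset
    (isCompact_univ_pi fun _ : Fin 3 => isCompact_univ_pi fun _ : Fin 3 =>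
      isCompact_Icc (a := (-1 : ℝ)) (b := 1)) isClosed_orthogonalGroup ?_
  intro A hA i _ j _
  have h := orth_row ⟨A, hA⟩ i i
  have h1 : A i j * A i j ≤ ∑ k, A i k * A i k :=
    Finset.single_le_sum (f := fun k => A i k * A i k)
      (fun k _ => mul_self_nonneg _) (Finset.mem_univ j)
  simp only [if_true] at h
  rw [h] at h1
  exact abs_le.1 (abs_le_one_iff_mul_self_le_one.2 h1)

instance : MeasurableSpace G := borel G
instance : BorelSpace G := ⟨rfl⟩
instance : SecondCountableTopology (Matrix (Fin 3) (Fin 3) ℝ) :=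
  inferInstanceAs (SecondCountableTopology (Fin 3 → Fin 3 → ℝ))
instance : SecondCountableTopology G := TopologicalSpace.Subtype.secondCountableTopology _

/-! ### The invariant measure on the frame bundle -/

abbrev Tor : Type := UnitAddTorus (Fin 3)

/-- The invariant measure on the bundle of orthonormal frames over `S² × T³`. -/
def frameMeasure : Measure (G × Tor) := (Measure.haar : Measure G).prod volume

instance : IsFiniteMeasure frameMeasure := by unfold frameMeasure; infer_instance
instance : frameMeasure.IsOpenPosMeasure := by unfold frameMeasure; infer_instance

theorem measurePreserving_rotate (r : G) :
    MeasurePreserving (fun k : G × Tor => (r * k.1, k.2)) frameMeasure frameMeasure :=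
  (measurePreserving_mul_left _ r).prod (MeasurePreserving.id _)

/-- The flow of W_a translates each torus fibre by an amount depending on the frame, hence a skew
product. -/
theorem measurePreserving_translate (c : G → Tor) (hc : Continuous c) :
    MeasurePreserving (fun k : G × Tor => (k.1, k.2 + c k.1)) frameMeasure frameMeasure := by
  refine MeasurePreserving.skew_product (f := id) (g := fun a t => t + c a)
    (MeasurePreserving.id _) ?_ ?_
  · exact (continuous_snd.add (hc.comp continuous_fst)).measurable
  · exact Filter.Eventually.of_forall fun a => map_add_right_eq_self _ _

/-- A continuous nonnegative function of integral zero vanishes. -/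
theorem eq_zero_of_integral_eq_zero {h : G × Tor → ℝ} (hc : Continuous h) (h0 : ∀ k, 0 ≤ h k)
    (hi : ∫ k, h k ∂frameMeasure = 0) (k : G × Tor) : h k = 0 := by
  have hint : Integrable h frameMeasure := by
    obtain ⟨D, hD⟩ := isCompact_univ.exists_bound_of_continuousOn hc.continuousOn
    exact Integrable.of_bound hc.measurable.aestronglyMeasurable D
      (Filter.Eventually.of_forall fun k => hD k (Set.mem_univ _))
  have h1 := (integral_eq_zero_iff_of_nonneg h0 hint).1 hi
  exact congrFun ((Continuous.ae_eq_iff_eq frameMeasure hc continuous_const).1 h1) k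

/-- The rotation by the angle `s` in the plane of the `a`-th and `b`-th vectors. -/
def rot (a b : Fin 3) (s : ℝ) : Matrix (Fin 3) (Fin 3) ℝ :=
  Matrix.of fun i j => if i = a then (if j = a then Real.cos s else if j = b then Real.sin s else 0)
    else if i = b then (if j = a then -Real.sin s else if j = b then Real.cos s else 0)
    else if i = j then 1 else 0

theorem rot_mem {a b : Fin 3} (hab : a ≠ b) (s : ℝ) :
    rot a b s ∈ Matrix.orthogonalGroup (Fin 3) ℝ := by
  have h := Real.cos_sq_add_sin_sq s
  rw [Matrix.mem_orthogonalGroup_iff]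
  ext i j
  fin_cases a <;> fin_cases b <;> (try exact absurd rfl hab) <;>
  fin_cases i <;> fin_cases j <;>
  simp [rot, Matrix.mul_apply, Fin.sum_univ_three] <;> nlinarith

def rotG {a b : Fin 3} (hab : a ≠ b) (s : ℝ) : G := ⟨rot a b s, rot_mem hab s⟩

/-! ### Calculus on the space of triples of vectors -/

/-- Pairs of a triple of vectors of `ℝ³` and a point of the cover `ℝ³` of `T³`. -/
abbrev N : Type := (Fin 3 → V) × V

/-- The vectors forming the rows of an orthogonal matrix. -/
def row (g : G) (i : Fin 3) : V := WithLp.toLp 2 (g.1 i)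

@[simp] theorem row_apply (g : G) (i j : Fin 3) : row g i j = g.1 i j := rfl

def frame (g : G) (y : V) : N := (row g, y)

theorem inner_row (g : G) (i j : Fin 3) : inner ℝ (row g i) (row g j) = if i = j then 1 else 0 := by
  rw [← orth_row g i j]
  simp [PiLp.inner_apply, mul_comm]

theorem norm_row (g : G) (i : Fin 3) : ‖row g i‖ = 1 := by
  have h := inner_row g i i
  rw [real_inner_self_eq_norm_sq, if_pos rfl] at h
  exact (pow_eq_one_iff_of_nonneg (norm_nonneg _) two_ne_zero).1 h

theorem row_ne_zero (g : G) (i : Fin 3) : row g i ≠ 0 := by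
  intro h
  simpa [h] using norm_row g i

theorem sum_inner_row (g : G) (v : V) : ∑ i, inner ℝ (row g i) v • row g i = v := by
  ext k
  have h : ∀ j, ∑ i, g.1 i j * g.1 i k = if j = k then 1 else 0 := fun j => orth_col g j k
  simp only [PiLp.inner_apply, Fin.sum_univ_three, row_apply, RCLike.inner_apply, conj_trivial,
    PiLp.add_apply, PiLp.smul_apply, smul_eq_mul] at h ⊢
  have h0 := h 0
  have h1 := h 1
  have h2 := h 2
  fin_cases k <;> simp at h0 h1 h2 ⊢ <;> linear_combination v 0 * h0 + v 1 * h1 + v 2 * h2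

def dom : Set N := {n | n.1 2 ≠ 0}

theorem isOpen_dom : IsOpen dom :=
  isOpen_ne_fun ((continuous_apply 2).comp continuous_fst) continuous_const

theorem frame_mem (g : G) (y : V) : frame g y ∈ dom := row_ne_zero g 2

/-- The class modulo `ℤ³`. -/
def torOf (y : V) : Tor := fun i => ((y i : ℝ) : UnitAddCircle)

theorem torOf_add (y z : V) : torOf (y + z) = torOf y + torOf z := rfl

theorem torOf_zero : torOf 0 = 0 := rfl

theorem isOpenQuotientMap_torOf : IsOpenQuotientMap torOf := by
  have h : IsOpenQuotientMap (fun (y : Fin 3 → ℝ) (i : Fin 3) => ((y i : ℝ) : UnitAddCircle)) :=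
    IsOpenQuotientMap.piMap fun _ => QuotientAddGroup.isOpenQuotientMap_mk
  exact h.comp (PiLp.homeomorph 2 fun _ : Fin 3 => ℝ).isOpenQuotientMap

/-- Functions live on an open set of the linear space of triples, not on the frame manifold, so that
iterated derivatives are ordinary ones. Periodicity in y lets them descend to the compact space O(3)
× T³. -/
structure IsGood (u : N → ℝ) : Prop where
  contDiffOn : ContDiffOn ℝ ∞ u dom
  periodic : ∀ n l, torOf l = 0 → u (n.1, n.2 + l) = u n

def lieD (A : N →L[ℝ] N) (u : N → ℝ) (n : N) : ℝ := fderiv ℝ u n (A n)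

namespace IsGood

variable {u w : N → ℝ}

theorem contDiffAt (h : IsGood u) {n : N} (hn : n ∈ dom) : ContDiffAt ℝ ∞ u n :=
  h.contDiffOn.contDiffAt (isOpen_dom.mem_nhds hn)

theorem differentiableAt (h : IsGood u) {n : N} (hn : n ∈ dom) : DifferentiableAt ℝ u n :=
  (h.contDiffAt hn).differentiableAt (by simp)

theorem add (h : IsGood u) (k : IsGood w) : IsGood (u + w) :=
  ⟨h.contDiffOn.add k.contDiffOn, fun n l hl => by
    simp only [Pi.add_apply, h.periodic n l hl, k.periodic n l hl]⟩

theorem sub (h : IsGood u) (k : IsGood w) : IsGood (u - w) :=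
  ⟨h.contDiffOn.sub k.contDiffOn, fun n l hl => by
    simp only [Pi.sub_apply, h.periodic n l hl, k.periodic n l hl]⟩

theorem neg (h : IsGood u) : IsGood (-u) :=
  ⟨h.contDiffOn.neg, fun n l hl => by simp only [Pi.neg_apply, h.periodic n l hl]⟩

theorem mul (h : IsGood u) (k : IsGood w) : IsGood (u * w) :=
  ⟨h.contDiffOn.mul k.contDiffOn, fun n l hl => by
    simp only [Pi.mul_apply, h.periodic n l hl, k.periodic n l hl]⟩

theorem fderiv_periodic (h : IsGood u) (n : N) (l : V) (hl : torOf l = 0) :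
    fderiv ℝ u (n.1, n.2 + l) = fderiv ℝ u n := by
  have h1 : (fun m : N => u (m + (0, l))) = u := by
    funext m
    have := h.periodic m l hl
    rwa [show (m.1, m.2 + l) = m + (0, l) by ext <;> simp] at this
  have h2 := fderiv_comp_add_right (𝕜 := ℝ) (f := u) (x := n) ((0, l) : N)
  rw [h1, show n + (0, l) = (n.1, n.2 + l) by ext <;> simp] at h2
  exact h2.symm

theorem contDiffOn_fderiv (h : IsGood u) : ContDiffOn ℝ ∞ (fderiv ℝ u) dom :=
  h.contDiffOn.fderiv_of_isOpen isOpen_dom (by simp)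

end IsGood

/-- The rotation vector field `e_a ↦ e_b`, `e_b ↦ -e_a`. -/
def rotField (a b : Fin 3) : N →L[ℝ] N :=
  (ContinuousLinearMap.pi fun i =>
    if i = a then (ContinuousLinearMap.proj b).comp (ContinuousLinearMap.fst ℝ (Fin 3 → V) V)
    else if i = b then -(ContinuousLinearMap.proj a).comp (ContinuousLinearMap.fst ℝ (Fin 3 → V) V)
    else 0).prod 0

/-- The vector field `e_a · ∂/∂y`. -/
def transField (a : Fin 3) : N →L[ℝ] N :=
  (0 : N →L[ℝ] (Fin 3 → V)).prod
    ((ContinuousLinearMap.proj a).comp (ContinuousLinearMap.fst ℝ (Fin 3 → V) V))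

theorem rotField_apply (a b : Fin 3) (n : N) : rotField a b n =
    (fun i => if i = a then n.1 b else if i = b then -n.1 a else 0, 0) := by
  ext i j
  · simp only [rotField, ContinuousLinearMap.prod_apply, ContinuousLinearMap.pi_apply]
    split_ifs <;> rfl
  · rfl

theorem transField_apply (a : Fin 3) (n : N) : transField a n = (0, n.1 a) := rfl

/-- The fields `A` tangent to the bundle of orthonormal frames. -/
inductive IsTangent : (N →L[ℝ] N) → Prop
  | rot {a b : Fin 3} (hab : a ≠ b) : IsTangent (rotField a b)
  | trans (a : Fin 3) : IsTangent (transField a)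

theorem periodic_field {A : N →L[ℝ] N} (hA : IsTangent A) (n : N) (l : V) :
    A (n.1, n.2 + l) = A n := by
  cases hA with
  | rot hab => simp [rotField_apply]
  | trans a => simp [transField_apply]

theorem IsGood.lieD {u : N → ℝ} (h : IsGood u) {A : N →L[ℝ] N} (hA : IsTangent A) :
    IsGood (lieD A u) where
  contDiffOn := h.contDiffOn_fderiv.clm_apply A.contDiff.contDiffOn
  periodic n l hl := by
    simp only [CYBoundary.lieD, h.fderiv_periodic n l hl, periodic_field hA]

/-- The fields are linear, so the second derivatives cancel by symmetry and the bracket is a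
commutator of linear maps, with A applied first in its positive term. -/
theorem lieD_comm {u : N → ℝ} (h : IsGood u) (A B : N →L[ℝ] N) {n : N} (hn : n ∈ dom) :
    lieD A (lieD B u) n - lieD B (lieD A u) n = fderiv ℝ u n (B (A n) - A (B n)) := by
  have hd : DifferentiableAt ℝ (fderiv ℝ u) n :=
    (h.contDiffOn_fderiv.contDiffAt (isOpen_dom.mem_nhds hn)).differentiableAt (by simp)
  have key : ∀ A B : N →L[ℝ] N, lieD A (lieD B u) n =
      fderiv ℝ (fderiv ℝ u) n (A n) (B n) + fderiv ℝ u n (B (A n)) := fun A B => by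
    have := (hd.hasFDerivAt.clm_apply B.hasFDerivAt).fderiv
    unfold lieD
    rw [this]
    simp [add_comm]
  have hs := (h.contDiffAt hn).isSymmSndFDerivAt (by
    simpa using WithTop.coe_le_coe.2 (le_top (a := (2 : ℕ∞)))) (A n) (B n)
  rw [key, key, hs, map_sub]
  ring

theorem lieD_mul {u w : N → ℝ} (h : IsGood u) (k : IsGood w) (A : N →L[ℝ] N) {n : N}
    (hn : n ∈ dom) : lieD A (u * w) n = u n * lieD A w n + w n * lieD A u n := by
  simp [lieD, fderiv_mul (h.differentiableAt hn) (k.differentiableAt hn)]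

theorem lieD_add {u w : N → ℝ} (h : IsGood u) (k : IsGood w) (A : N →L[ℝ] N) {n : N}
    (hn : n ∈ dom) : lieD A (u + w) n = lieD A u n + lieD A w n := by
  simp [lieD, fderiv_add (h.differentiableAt hn) (k.differentiableAt hn)]

theorem lieD_sub {u w : N → ℝ} (h : IsGood u) (k : IsGood w) (A : N →L[ℝ] N) {n : N}
    (hn : n ∈ dom) : lieD A (u - w) n = lieD A u n - lieD A w n := by
  simp [lieD, fderiv_sub (h.differentiableAt hn) (k.differentiableAt hn)]

theorem lieD_neg {u : N → ℝ} (A : N →L[ℝ] N) (n : N) : lieD A (-u) n = -lieD A u n := by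
  simp [lieD, fderiv_neg]

/-! ### Flows -/

theorem hasDerivAt_frame_rot {a b : Fin 3} (hab : a ≠ b) (g : G) (y : V) (s : ℝ) :
    HasDerivAt (fun s => frame (rotG hab s * g) y)
      (rotField a b (frame (rotG hab s * g) y)) s := by
  rw [rotField_apply]
  refine HasDerivAt.prodMk (hasDerivAt_pi.2 fun i => ?_) (hasDerivAt_const s y)
  have hrow : ∀ i s, row (rotG hab s * g) i =
      if i = a then Real.cos s • row g a + Real.sin s • row g b
      else if i = b then -Real.sin s • row g a + Real.cos s • row g b else row g i := by
    intro i s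
    ext k
    -- Left multiplication combines rows, so it rotates the vectors of the frame among themselves.
    have : (rotG hab s * g).1 i k = ∑ j, rot a b s i j * g.1 j k := Matrix.mul_apply
    rw [row_apply, this]
    clear this
    revert hab
    fin_cases a <;> fin_cases b <;> fin_cases i <;> simp [rot, Fin.sum_univ_three] <;>
      ring
  simp only [frame, hrow, if_true, if_neg hab.symm]
  split_ifs
  · have := ((Real.hasDerivAt_cos s).smul_const (row g a)).add
      ((Real.hasDerivAt_sin s).smul_const (row g b))
    exact this
  · have := ((Real.hasDerivAt_sin s).neg.smul_const (row g a)).add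
      ((Real.hasDerivAt_cos s).smul_const (row g b))
    rw [neg_smul, neg_smul, ← neg_add] at this
    exact this
  · exact hasDerivAt_const _ _

theorem hasDerivAt_frame_trans (a : Fin 3) (g : G) (y : V) (s : ℝ) :
    HasDerivAt (fun s => frame g (y + s • row g a)) (transField a (frame g (y + s • row g a))) s := by
  refine HasDerivAt.prodMk (hasDerivAt_const s _) ?_
  simpa [frame] using ((hasDerivAt_id s).smul_const (row g a)).const_add y

theorem IsGood.hasDerivAt_comp {u : N → ℝ} (h : IsGood u) {A : N →L[ℝ] N} {g : ℝ → G} {y : ℝ → V}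
    {s : ℝ} (hc : HasDerivAt (fun s => frame (g s) (y s)) (A (frame (g s) (y s))) s) :
    HasDerivAt (fun s => u (frame (g s) (y s))) (CYBoundary.lieD A u (frame (g s) (y s))) s :=
  (h.differentiableAt (frame_mem _ _)).hasFDerivAt.comp_hasDerivAt s hc

theorem rotG_zero {a b : Fin 3} (hab : a ≠ b) : rotG hab 0 = 1 := by
  ext i j
  simp only [rotG, rot, Real.cos_zero, Real.sin_zero, Matrix.of_apply]
  revert hab
  fin_cases a <;> fin_cases b <;> fin_cases i <;> fin_cases j <;> simp

/-- Through every frame there passes an integral curve of a tangent field. -/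
theorem IsTangent.exists_curve {A : N →L[ℝ] N} (hA : IsTangent A) (g : G) (y : V) :
    ∃ (c : ℝ → G) (z : ℝ → V), c 0 = g ∧ z 0 = y ∧
      ∀ s, HasDerivAt (fun s => frame (c s) (z s)) (A (frame (c s) (z s))) s := by
  cases hA with
  | rot hab => exact ⟨fun s => rotG hab s * g, fun _ => y, by simp [rotG_zero], rfl,
      hasDerivAt_frame_rot hab g y⟩
  | trans a => exact ⟨fun _ => g, fun s => y + s • row g a, rfl, by simp,
      hasDerivAt_frame_trans a g y⟩

/-- An integral curve of a tangent field that starts at a frame stays among the frames. Identities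
valid only on frames, such as those from anti-self-duality, may therefore be differentiated along
tangent fields. -/
theorem lieD_congr {u w : N → ℝ} (h : IsGood u) (k : IsGood w) {A : N →L[ℝ] N} (hA : IsTangent A)
    (he : ∀ g y, u (frame g y) = w (frame g y)) (g : G) (y : V) :
    lieD A u (frame g y) = lieD A w (frame g y) := by
  obtain ⟨c, z, rfl, rfl, hc⟩ := hA.exists_curve g y
  have h1 := h.hasDerivAt_comp (hc 0)
  have h2 := k.hasDerivAt_comp (hc 0)
  simp only [he] at h1
  exact h1.unique h2

/-! ### Descent to `O(3) × T³` -/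

/-- The function on `O(3) × T³` induced by a periodic function. -/
def desc (u : N → ℝ) (k : G × Tor) : ℝ :=
  u (frame k.1 (isOpenQuotientMap_torOf.surjective k.2).choose)

theorem desc_torOf {u : N → ℝ} (h : IsGood u) (g : G) (y : V) :
    desc u (g, torOf y) = u (frame g y) := by
  have hc := (isOpenQuotientMap_torOf.surjective (torOf y)).choose_spec
  unfold desc
  generalize (isOpenQuotientMap_torOf.surjective (torOf y)).choose = z at hc
  have hl : torOf (z - y) = 0 := by
    have := torOf_add (z - y) y
    rw [sub_add_cancel, hc] at this
    exact left_eq_add.1 (by rw [add_comm]; exact this)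
  have := h.periodic (frame g y) (z - y) hl
  simpa [frame] using this

theorem continuous_row : Continuous row := by
  refine continuous_pi fun i => (PiLp.continuous_toLp 2 _).comp ?_
  exact (continuous_apply i).comp continuous_subtype_val

theorem continuous_desc {u : N → ℝ} (h : IsGood u) : Continuous (desc u) := by
  have hq := (IsOpenQuotientMap.id (X := G)).prodMap isOpenQuotientMap_torOf
  rw [hq.isQuotientMap.continuous_iff]
  have : desc u ∘ Prod.map id torOf = fun k : G × V => u (frame k.1 k.2) := by
    funext k
    exact desc_torOf h k.1 k.2
  rw [this]
  exact h.contDiffOn.continuousOn.comp_continuous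
    ((continuous_row.comp continuous_fst).prodMk continuous_snd) fun k => frame_mem _ _

theorem integral_desc_lieD {u : N → ℝ} (h : IsGood u) {A : N →L[ℝ] N} (hA : IsTangent A) :
    ∫ k, desc (lieD A u) k ∂frameMeasure = 0 := by
  have h' := h.lieD hA
  cases hA with
  | @rot a b hab =>
    refine integral_flow_deriv_eq_zero (fun s k => (rotG hab s * k.1, k.2))
      (fun s => measurePreserving_rotate _) (continuous_desc h) (continuous_desc h')
      (fun k => by simp [rotG_zero]) fun ⟨g, t⟩ s => ?_
    obtain ⟨y, rfl⟩ := isOpenQuotientMap_torOf.surjective t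
    simp only [desc_torOf h, desc_torOf h']
    exact h.hasDerivAt_comp (hasDerivAt_frame_rot hab g y s)
  | trans a =>
    refine integral_flow_deriv_eq_zero (fun s k => (k.1, k.2 + torOf (s • row k.1 a)))
      (fun s => measurePreserving_translate (fun g => torOf (s • row g a)) ?_)
      (continuous_desc h) (continuous_desc h') (fun k => ?_) fun ⟨g, t⟩ s => ?_
    · exact isOpenQuotientMap_torOf.continuous.comp
        (((continuous_apply a).comp continuous_row).const_smul s)
    · rw [zero_smul, torOf_zero, add_zero]
    obtain ⟨y, rfl⟩ := isOpenQuotientMap_torOf.surjective t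
    simp only [← torOf_add, desc_torOf h, desc_torOf h']
    exact h.hasDerivAt_comp (hasDerivAt_frame_trans a g y s)

/-- Integration by parts: an eigenfunction with nonnegative eigenvalue of a sum of squares of
tangent fields is annihilated by these fields. -/
theorem lieD_eq_zero_of_sum_sq {ι : Type*} [Fintype ι] {u : N → ℝ} (h : IsGood u)
    (A : ι → N →L[ℝ] N) (hA : ∀ i, IsTangent (A i)) {c : ℝ} (hc : 0 ≤ c)
    (he : ∀ g y, ∑ i, lieD (A i) (lieD (A i) u) (frame g y) = c * u (frame g y)) (g : G) (y : V) :
    (∀ i, lieD (A i) u (frame g y) = 0) ∧ c * u (frame g y) ^ 2 = 0 := by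
  have hg : ∀ i, IsGood (lieD (A i) u) := fun i => h.lieD (hA i)
  have hm : ∀ i, IsGood (lieD (A i) (u * lieD (A i) u)) := fun i => (h.mul (hg i)).lieD (hA i)
  -- The product rule: ∑ A_i(u A_i u) = ∑ (A_i u)² + u ∑ A_i² u. The left side has integral zero,
  -- and both terms on the right are nonnegative.
  have hsum : ∀ k, ∑ i, desc (lieD (A i) (u * lieD (A i) u)) k =
      ∑ i, desc (lieD (A i) u) k ^ 2 + c * desc u k ^ 2 := by
    rintro ⟨g, t⟩
    obtain ⟨y, rfl⟩ := isOpenQuotientMap_torOf.surjective t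
    simp only [desc_torOf h, desc_torOf (hm _), desc_torOf (hg _),
      lieD_mul h (hg _) _ (frame_mem g y), Finset.sum_add_distrib, ← Finset.mul_sum, he]
    simp only [sq]
    ring
  have hint : ∫ k, ∑ i, desc (lieD (A i) (u * lieD (A i) u)) k ∂frameMeasure = 0 := by
    rw [integral_finsetSum]
    · exact Finset.sum_eq_zero fun i _ => integral_desc_lieD (h.mul (hg i)) (hA i)
    · intro i _
      have hcont := continuous_desc (hm i)
      obtain ⟨D, hD⟩ := isCompact_univ.exists_bound_of_continuousOn hcont.continuousOn
      exact Integrable.of_bound hcont.measurable.aestronglyMeasurable D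
        (Filter.Eventually.of_forall fun k => hD k (Set.mem_univ _))
  simp only [hsum] at hint
  have hcont : Continuous fun k => ∑ i, desc (lieD (A i) u) k ^ 2 + c * desc u k ^ 2 :=
    (continuous_finsetSum _ fun i _ => (continuous_desc (hg i)).pow 2).add
      (continuous_const.mul ((continuous_desc h).pow 2))
  have hs : ∀ k, 0 ≤ ∑ i, desc (lieD (A i) u) k ^ 2 := fun k =>
    Finset.sum_nonneg fun i _ => sq_nonneg _
  have ht : ∀ k, 0 ≤ c * desc u k ^ 2 := fun k => mul_nonneg hc (sq_nonneg _)
  have h0 := eq_zero_of_integral_eq_zero hcont (fun k => add_nonneg (hs k) (ht k)) hint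
    (g, torOf y)
  rw [add_eq_zero_iff_of_nonneg (hs _) (ht _)] at h0
  simp only [desc_torOf h, desc_torOf (hg _)] at h0
  refine ⟨fun i => ?_, h0.2⟩
  have := (Finset.sum_eq_zero_iff_of_nonneg fun i _ => sq_nonneg _).1 h0.1 i (Finset.mem_univ i)
  exact pow_eq_zero_iff two_ne_zero |>.1 this

/-! ### Commutators -/

theorem lieD_comm_rot_trans {u : N → ℝ} (h : IsGood u) (b c : Fin 3) (hc : c ≠ 2) {n : N}
    (hn : n ∈ dom) : lieD (rotField 2 b) (lieD (transField c) u) n -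
      lieD (transField c) (lieD (rotField 2 b) u) n =
        if c = b then -lieD (transField 2) u n else 0 := by
  rw [lieD_comm h _ _ hn, rotField_apply, rotField_apply, transField_apply, transField_apply]
  simp only [hc, if_false]
  have : (fun i : Fin 3 => if i = 2 then (0 : Fin 3 → V) b
      else if i = b then -(0 : Fin 3 → V) 2 else 0) = 0 := by
    funext i
    simp
  rw [this, Prod.mk_zero_zero, sub_zero]
  split_ifs with hcb
  · rw [lieD, transField_apply, ← map_neg]
    simp
  · exact map_zero _

theorem lieD_comm_rot {u : N → ℝ} (h : IsGood u) {n : N} (hn : n ∈ dom) :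
    lieD (rotField 2 0) (lieD (rotField 2 1) u) n - lieD (rotField 2 1) (lieD (rotField 2 0) u) n =
      lieD (rotField 0 1) u n := by
  rw [lieD_comm h _ _ hn, lieD]
  congr 1
  simp only [rotField_apply]
  ext i j
  · fin_cases i <;> simp
  · simp

/-! ### The first order system -/

/-- The equations satisfied by the components of a closed anti-self-dual form. -/
structure IsSystem (f p r : N → ℝ) : Prop where
  good_f : IsGood f
  good_p : IsGood p
  good_r : IsGood r
  trans_zero : ∀ g y, lieD (transField 0) f (frame g y) =
    lieD (rotField 2 1) p (frame g y) - lieD (rotField 2 0) r (frame g y)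
  trans_one : ∀ g y, lieD (transField 1) f (frame g y) =
    lieD (rotField 2 0) p (frame g y) + lieD (rotField 2 1) r (frame g y)
  rot_zero : ∀ g y, lieD (rotField 2 0) f (frame g y) =
    lieD (transField 0) r (frame g y) - lieD (transField 1) p (frame g y)
  rot_one : ∀ g y, lieD (rotField 2 1) f (frame g y) =
    -(lieD (transField 0) p (frame g y) + lieD (transField 1) r (frame g y))
  spin_p : ∀ g y, lieD (rotField 0 1) p (frame g y) = 2 * r (frame g y)
  spin_r : ∀ g y, lieD (rotField 0 1) r (frame g y) = -(2 * p (frame g y))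

namespace IsSystem

variable {f p r : N → ℝ}

theorem tangent_rot {a b : Fin 3} (hab : a ≠ b := by decide) : IsTangent (rotField a b) := .rot hab

/-- With c = 0 in `lieD_eq_zero_of_sum_sq`: f is annihilated by the sum of the squares of X₀, X₁,
W₀, W₁. -/
theorem horizontal_derivs (S : IsSystem f p r) (g : G) (y : V) :
    lieD (rotField 2 0) f (frame g y) = 0 ∧ lieD (rotField 2 1) f (frame g y) = 0 ∧
    lieD (transField 0) f (frame g y) = 0 ∧ lieD (transField 1) f (frame g y) = 0 := by
  obtain ⟨hf, hp, hr, e1, e2, e3, e4, -, -⟩ := S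
  have X1 : IsTangent (rotField 2 0) := tangent_rot
  have X2 : IsTangent (rotField 2 1) := tangent_rot
  have W1 : IsTangent (transField 0) := .trans 0
  have W2 : IsTangent (transField 1) := .trans 1
  have key := lieD_eq_zero_of_sum_sq hf
    ![rotField 2 0, rotField 2 1, transField 0, transField 1]
    (by intro i; fin_cases i <;> [exact X1; exact X2; exact W1; exact W2]) le_rfl (c := 0) ?_ g y
  · exact ⟨key.1 0, key.1 1, key.1 2, key.1 3⟩
  intro g y
  have hn := frame_mem g y
  have d3 := lieD_congr (hf.lieD X1) ((hr.lieD W1).sub (hp.lieD W2)) X1 e3 g y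
  have d4 := lieD_congr (hf.lieD X2) ((hp.lieD W1).add (hr.lieD W2)).neg X2 e4 g y
  have d1 := lieD_congr (hf.lieD W1) ((hp.lieD X2).sub (hr.lieD X1)) W1 e1 g y
  have d2 := lieD_congr (hf.lieD W2) ((hp.lieD X1).add (hr.lieD X2)) W2 e2 g y
  rw [lieD_sub (hr.lieD W1) (hp.lieD W2) _ hn] at d3
  rw [lieD_neg, lieD_add (hp.lieD W1) (hr.lieD W2) _ hn] at d4
  rw [lieD_sub (hp.lieD X2) (hr.lieD X1) _ hn] at d1
  rw [lieD_add (hp.lieD X1) (hr.lieD X2) _ hn] at d2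
  -- The sum of squares equals [X₀,W₀]r - [X₁,W₁]r - [X₀,W₁]p - [X₁,W₀]p. The first two terms are
  -- -W₂r and W₂r; the others vanish.
  have c1 := lieD_comm_rot_trans hr 0 0 (by decide) hn
  have c2 := lieD_comm_rot_trans hr 1 1 (by decide) hn
  have c3 := lieD_comm_rot_trans hp 0 1 (by decide) hn
  have c4 := lieD_comm_rot_trans hp 1 0 (by decide) hn
  simp at c1 c2 c3 c4
  simp [Fin.sum_univ_four]
  linarith

/-- Once the derivatives of f are gone, p and r satisfy Cauchy-Riemann equations along the sphere,
and their weight 2 under Z supplies a positive eigenvalue. -/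
theorem p_r_eq_zero (S : IsSystem f p r) (g : G) (y : V) :
    p (frame g y) = 0 ∧ r (frame g y) = 0 := by
  have X1 : IsTangent (rotField 2 0) := tangent_rot
  have X2 : IsTangent (rotField 2 1) := tangent_rot
  have H := S.horizontal_derivs
  obtain ⟨hf, hp, hr, e1, e2, -, -, e5, e6⟩ := S
  have a1 : ∀ g y, lieD (rotField 2 1) p (frame g y) = lieD (rotField 2 0) r (frame g y) :=
    fun g y => by linarith [e1 g y, (H g y).2.2.1]
  have a2 : ∀ g y, lieD (rotField 2 0) p (frame g y) = (-lieD (rotField 2 1) r) (frame g y) :=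
    fun g y => by simp only [Pi.neg_apply]; linarith [e2 g y, (H g y).2.2.2]
  have key : ∀ g y, p (frame g y) = 0 := by
    intro g y
    have key := lieD_eq_zero_of_sum_sq hp ![rotField 2 0, rotField 2 1]
      (by intro i; fin_cases i <;> [exact X1; exact X2]) zero_le_two (c := 2) ?_ g y
    · have := key.2
      simpa using this
    -- (X₀² + X₁²)p = -(X₀X₁ - X₁X₀)r = -Zr = 2p.
    intro g y
    have d1 := lieD_congr (hp.lieD X2) (hr.lieD X1) X2 a1 g y
    have d2 := lieD_congr (hp.lieD X1) (hr.lieD X2).neg X1 a2 g y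
    rw [lieD_neg] at d2
    have c := lieD_comm_rot hr (frame_mem g y)
    simp [Fin.sum_univ_two]
    linarith [e6 g y]
  refine ⟨key g y, ?_⟩
  have X3 : IsTangent (rotField 0 1) := tangent_rot
  have h0 : IsGood (0 : N → ℝ) := ⟨contDiffOn_const, fun _ _ _ => rfl⟩
  have d := lieD_congr hp h0 X3 key g y
  have : lieD (rotField 0 1) (0 : N → ℝ) (frame g y) = 0 := by simp [lieD]
  linarith [e5 g y]

theorem lieD_f_eq_zero (S : IsSystem f p r) :
    (∀ g y, lieD (rotField 0 1) f (frame g y) = 0) ∧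
      ∀ a g y, lieD (transField a) f (frame g y) = 0 := by
  have X1 : IsTangent (rotField 2 0) := tangent_rot
  have X2 : IsTangent (rotField 2 1) := tangent_rot
  have W1 : IsTangent (transField 0) := .trans 0
  have H := S.horizontal_derivs
  have hf := S.good_f
  have h0 : IsGood (0 : N → ℝ) := ⟨contDiffOn_const, fun _ _ _ => rfl⟩
  have hz : ∀ {A B : N →L[ℝ] N}, IsTangent A → IsTangent B →
      (∀ g y, lieD B f (frame g y) = 0) → ∀ g y, lieD A (lieD B f) (frame g y) = 0 := by
    intro A B hA hB h g y
    rw [lieD_congr (hf.lieD hB) h0 hA h g y]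
    simp [lieD]
  refine ⟨fun g y => ?_, fun a g y => ?_⟩
  · rw [← lieD_comm_rot hf (frame_mem g y), hz X1 X2 (fun g y => (H g y).2.1),
      hz X2 X1 (fun g y => (H g y).1), sub_zero]
  · fin_cases a
    · exact (H g y).2.2.1
    · exact (H g y).2.2.2
    -- W₂ is recovered as -[X₀, W₀].
    · have := lieD_comm_rot_trans hf 0 0 (by decide) (frame_mem g y)
      rw [hz X1 W1 (fun g y => (H g y).2.2.1), hz W1 X1 (fun g y => (H g y).1), if_pos rfl] at this
      show lieD (transField 2) f (frame g y) = 0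
      linarith

theorem const_along {A : N →L[ℝ] N} (hf : IsGood f) {c : ℝ → G} {z : ℝ → V}
    (hc : ∀ s, HasDerivAt (fun s => frame (c s) (z s)) (A (frame (c s) (z s))) s)
    (h : ∀ g y, lieD A f (frame g y) = 0) (s t : ℝ) :
    f (frame (c s) (z s)) = f (frame (c t) (z t)) := by
  have hd : ∀ s, HasDerivAt (fun s => f (frame (c s) (z s))) 0 s := fun s => by
    have := hf.hasDerivAt_comp (hc s)
    rwa [h] at this
  exact is_const_of_deriv_eq_zero (fun s => (hd s).differentiableAt) (fun s => (hd s).deriv) s t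

/-- Moving along flows of fields that annihilate f joins these frames to the standard one. Frames of
determinant -1 are not reached, nor needed: f changes sign with the orientation. -/
theorem f_rot (S : IsSystem f p r) (s t : ℝ) (y : V) :
    f (frame (rotG (show (2 : Fin 3) ≠ 0 by decide) s *
      (rotG (show (0 : Fin 3) ≠ 1 by decide) t * 1)) y) = f (frame 1 0) := by
  have hf := S.good_f
  obtain ⟨h3, hW⟩ := S.lieD_f_eq_zero
  have b1 := const_along hf (hasDerivAt_frame_rot (show (2 : Fin 3) ≠ 0 by decide)
    (rotG (show (0 : Fin 3) ≠ 1 by decide) t * 1) y) (fun g y => (S.horizontal_derivs g y).1) s 0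
  have b2 := const_along hf (hasDerivAt_frame_rot (show (0 : Fin 3) ≠ 1 by decide) 1 y) h3 t 0
  simp only [rotG_zero, one_mul] at b1 b2
  rw [b1, b2]
  have b3 : ∀ a (y : V) (s : ℝ), f (frame 1 (y + s • row 1 a)) = f (frame 1 y) := fun a y s => by
    have := const_along hf (hasDerivAt_frame_trans a 1 y) (hW a) s 0
    simpa using this
  have hy := sum_inner_row 1 y
  rw [Fin.sum_univ_three] at hy
  rw [← hy, b3, b3]
  simpa using b3 0 0 (inner ℝ (row 1 0) y)

end IsSystem

/-- Every unit vector is the last vector of a frame obtained from the standard one by two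
rotations. -/
theorem exists_frame_of_norm_eq_one {x : V} (hx : ‖x‖ = 1) :
    ∃ s t : ℝ, row (rotG (show (2 : Fin 3) ≠ 0 by decide) s *
      (rotG (show (0 : Fin 3) ≠ 1 by decide) t * 1)) 2 = x := by
  have hsq : x 0 ^ 2 + x 1 ^ 2 + x 2 ^ 2 = 1 := by
    have := EuclideanSpace.norm_sq_eq x
    rw [hx, Fin.sum_univ_three] at this
    simpa using this.symm
  -- Spherical coordinates: x = (sin s cos t, sin s sin t, cos s), with t the argument of x₀ + i x₁
  -- and s that of x₂ + iρ, where ρ = |x₀ + i x₁|.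
  obtain ⟨t, ht0, ht1⟩ : ∃ t : ℝ, ‖(⟨x 0, x 1⟩ : ℂ)‖ * Real.cos t = x 0 ∧
      ‖(⟨x 0, x 1⟩ : ℂ)‖ * Real.sin t = x 1 :=
    ⟨Complex.arg ⟨x 0, x 1⟩, Complex.norm_mul_cos_arg _, Complex.norm_mul_sin_arg _⟩
  set ρ := ‖(⟨x 0, x 1⟩ : ℂ)‖ with hρ
  have hρ2 : ρ ^ 2 = x 0 ^ 2 + x 1 ^ 2 := by
    rw [hρ, ← Complex.normSq_eq_norm_sq, Complex.normSq_mk]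
    ring
  have hn : ‖(⟨x 2, ρ⟩ : ℂ)‖ = 1 := by
    have : ‖(⟨x 2, ρ⟩ : ℂ)‖ ^ 2 = 1 := by
      rw [← Complex.normSq_eq_norm_sq, Complex.normSq_mk]
      linarith
    exact (pow_eq_one_iff_of_nonneg (norm_nonneg _) two_ne_zero).1 this
  have hs0 := Complex.norm_mul_cos_arg ⟨x 2, ρ⟩
  have hs1 := Complex.norm_mul_sin_arg ⟨x 2, ρ⟩
  rw [hn, one_mul] at hs0 hs1
  simp only at hs0 hs1
  refine ⟨Complex.arg ⟨x 2, ρ⟩, t, ?_⟩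
  ext k
  rw [row_apply]
  have : ∀ g h : G, (g * h).1 = g.1 * h.1 := fun _ _ => rfl
  rw [mul_one, this, Matrix.mul_apply]
  fin_cases k <;> simp [rotG, rot, Fin.sum_univ_three, hs0, hs1, ht0, ht1]

/-! ### Low-degree wedge products -/

section Algebra

variable {F : Type*} [NormedAddCommGroup F] [NormedSpace ℝ F]
variable {A : Type*} [NormedCommRing A] [NormedAlgebra ℝ A]

theorem sum_perm_three {A : Type*} [AddCommGroup A] (f : Fin 3 → Fin 3 → Fin 3 → A) :
    ∑ s : Equiv.Perm (Fin 3), Equiv.Perm.sign s • f (s 0) (s 1) (s 2) =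
      f 0 1 2 + -f 0 2 1 + (-f 1 0 2 + f 1 2 0 + (-f 2 1 0 + f 2 0 1)) := by
  simp only [Finset.univ_perm_fin_succ, Finset.sum_map, ← Finset.univ_product_univ,
    Finset.sum_product, Fin.sum_univ_succ]
  simp
  rfl

theorem sum_perm_four {A : Type*} [AddCommGroup A] (f : Fin 4 → Fin 4 → Fin 4 → Fin 4 → A) :
    ∑ s : Equiv.Perm (Fin 4), Equiv.Perm.sign s • f (s 0) (s 1) (s 2) (s 3) =
      f 0 1 2 3 + -f 0 1 3 2 + (-f 0 2 1 3 + f 0 2 3 1 + (-f 0 3 2 1 + f 0 3 1 2)) +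
        (-f 1 0 2 3 + f 1 0 3 2 + (f 1 2 0 3 + -f 1 2 3 0 + (f 1 3 2 0 + -f 1 3 0 2)) +
          (-f 2 1 0 3 + f 2 1 3 0 + (f 2 0 1 3 + -f 2 0 3 1 + (f 2 3 0 1 + -f 2 3 1 0)) +
            (-f 3 1 2 0 + f 3 1 0 2 + (f 3 2 1 0 + -f 3 2 0 1 +
              (f 3 0 2 1 + -f 3 0 1 2))))) := by
  simp only [Finset.univ_perm_fin_succ, Finset.sum_map, ← Finset.univ_product_univ,
    Finset.sum_product, Fin.sum_univ_succ]
  simp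
  rfl

@[simp] theorem oneForm_apply (f : F →L[ℝ] A) (v : Fin 1 → F) : oneForm f v = f (v 0) := rfl

theorem wedge_one_one (f g : F →L[ℝ] A) (v : Fin 2 → F) :
    wedge (oneForm f) (oneForm g) v = f (v 0) * g (v 1) - f (v 1) * g (v 0) := by
  rw [wedge_apply]
  simp only [Finset.univ_perm_fin_succ, Finset.sum_map, ← Finset.univ_product_univ,
    Finset.sum_product, Fin.sum_univ_succ]
  simp [sub_eq_add_neg]

theorem alt_swap (a : F [⋀^Fin 2]→L[ℝ] A) (u v : F) : a ![v, u] = -a ![u, v] := by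
  have := a.toAlternatingMap.map_swap ![u, v] (show (0 : Fin 2) ≠ 1 by decide)
  have h : ![u, v] ∘ Equiv.swap (0 : Fin 2) 1 = ![v, u] := by
    funext i
    fin_cases i <;> rfl
  rw [h] at this
  exact this

theorem wedge_two_one (a : F [⋀^Fin 2]→L[ℝ] A) (g : F →L[ℝ] A) (v : Fin 3 → F) :
    wedge a (oneForm g) v = a ![v 0, v 1] * g (v 2) - a ![v 0, v 2] * g (v 1) +
      a ![v 1, v 2] * g (v 0) := by
  have h : ∀ s : Equiv.Perm (Fin 3), (a fun i => v (s (Fin.castAdd 1 i))) = a ![v (s 0), v (s 1)] :=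
    fun s => congrArg a (by funext i; fin_cases i <;> rfl)
  rw [wedge_apply]
  simp only [h, oneForm_apply]
  have := sum_perm_three fun i j k => a ![v i, v j] * g (v k)
  refine (congrArg _ this).trans ?_
  rw [alt_swap a (v 0) (v 1), alt_swap a (v 0) (v 2), alt_swap a (v 1) (v 2),
    inv_smul_eq_iff₀ (by positivity)]
  simp only [Nat.factorial, Algebra.smul_def]
  norm_num
  simp only [map_ofNat]
  ring

theorem wedge_two_two (a b : F [⋀^Fin 2]→L[ℝ] A) (v : Fin 4 → F) :
    wedge a b v = a ![v 0, v 1] * b ![v 2, v 3] - a ![v 0, v 2] * b ![v 1, v 3] +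
      a ![v 0, v 3] * b ![v 1, v 2] + a ![v 1, v 2] * b ![v 0, v 3] -
      a ![v 1, v 3] * b ![v 0, v 2] + a ![v 2, v 3] * b ![v 0, v 1] := by
  have h : ∀ s : Equiv.Perm (Fin 4), (a fun i => v (s (Fin.castAdd 2 i))) = a ![v (s 0), v (s 1)] :=
    fun s => congrArg a (by funext i; fin_cases i <;> rfl)
  have h' : ∀ s : Equiv.Perm (Fin 4), (b fun i => v (s (Fin.natAdd 2 i))) = b ![v (s 2), v (s 3)] :=
    fun s => congrArg b (by funext i; fin_cases i <;> rfl)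
  rw [wedge_apply]
  simp only [h, h']
  have := sum_perm_four fun i j k l => a ![v i, v j] * b ![v k, v l]
  refine (congrArg _ this).trans ?_
  -- Antisymmetry groups the 24 terms into six, each occurring 2! · 2! = 4 times, which cancels the
  -- normalisation.
  rw [alt_swap a (v 0) (v 1), alt_swap a (v 0) (v 2), alt_swap a (v 1) (v 2),
    alt_swap a (v 0) (v 3), alt_swap a (v 1) (v 3), alt_swap a (v 2) (v 3),
    alt_swap b (v 0) (v 1), alt_swap b (v 0) (v 2), alt_swap b (v 1) (v 2),
    alt_swap b (v 0) (v 3), alt_swap b (v 1) (v 3), alt_swap b (v 2) (v 3),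
    inv_smul_eq_iff₀ (by positivity)]
  simp only [Nat.factorial, Algebra.smul_def]
  norm_num
  simp only [map_ofNat]
  ring

/-- A form of degree two as a bilinear form. -/
def bil : (F [⋀^Fin 2]→L[ℝ] ℝ) →L[ℝ] F →L[ℝ] F →L[ℝ] ℝ :=
  (ContinuousLinearMap.compL ℝ F (F [⋀^Fin 1]→L[ℝ] ℝ) (F →L[ℝ] ℝ)
    (ContinuousAlternatingMap.ofSubsingletonLIE
      (0 : Fin 1)).symm.toContinuousLinearEquiv.toContinuousLinearMap).comp
  ContinuousAlternatingMap.curryLeftLI.toContinuousLinearMap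

theorem bil_apply (a : F [⋀^Fin 2]→L[ℝ] ℝ) (u v : F) : bil a u v = a ![u, v] := by
  refine congrArg a ?_
  funext i
  fin_cases i <;> rfl

set_option maxSynthPendingDepth 3 in
theorem contDiffOn_bil {P : Type*} [NormedAddCommGroup P] [NormedSpace ℝ P]
    {η : P → F [⋀^Fin 2]→L[ℝ] ℝ} {s : Set P} (h : ContDiffOn ℝ ∞ η s) :
    ContDiffOn ℝ ∞ (fun q => bil (η q)) s :=
  (bil (F := F)).contDiff.comp_contDiffOn h

set_option maxSynthPendingDepth 3 in
theorem fderiv_bil_apply {P : Type*} [NormedAddCommGroup P] [NormedSpace ℝ P]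
    {B : F → F →L[ℝ] F →L[ℝ] ℝ} (κ a b : P →L[ℝ] F) {n : P} (h : DifferentiableAt ℝ B (κ n))
    (w : P) : fderiv ℝ (fun m => B (κ m) (a m) (b m)) n w =
      fderiv ℝ B (κ n) (κ w) (a n) (b n) + B (κ n) (a w) (b n) + B (κ n) (a n) (b w) := by
  have h1 : HasFDerivAt (fun m => B (κ m)) ((fderiv ℝ B (κ n)).comp κ) n :=
    h.hasFDerivAt.comp n κ.hasFDerivAt
  rw [((h1.clm_apply a.hasFDerivAt).clm_apply b.hasFDerivAt).fderiv]
  simp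
  ring

set_option maxSynthPendingDepth 3 in
theorem fderiv_bil_apply_const {B : F → F →L[ℝ] F →L[ℝ] ℝ} {q : F} (h : DifferentiableAt ℝ B q)
    (u v w : F) : fderiv ℝ (fun q => B q u v) q w = fderiv ℝ B q w u v := by
  rw [((h.hasFDerivAt.clm_apply (hasFDerivAt_const u q)).clm_apply (hasFDerivAt_const v q)).fderiv]
  simp

end Algebra

/-! ### The triple product -/

/-- The determinant of three vectors of `ℝ³`. -/
def trip (x u v : V) : ℝ :=
  x 0 * (u 1 * v 2 - u 2 * v 1) + x 1 * (u 2 * v 0 - u 0 * v 2) + x 2 * (u 0 * v 1 - u 1 * v 0)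

theorem trip_eq_det (x u v : V) :
    trip x u v = (EuclideanSpace.basisFun (Fin 3) ℝ).toBasis.det ![x, u, v] := by
  rw [Module.Basis.det_apply, Matrix.det_fin_three]
  simp [trip, Module.Basis.toMatrix_apply]
  ring

theorem trip_map (R : V ≃ₗᵢ[ℝ] V) (hR : LinearMap.det (R.toLinearEquiv : V →ₗ[ℝ] V) = 1)
    (x u v : V) : trip (R x) (R u) (R v) = trip x u v := by
  have := Module.Basis.det_comp (EuclideanSpace.basisFun (Fin 3) ℝ).toBasis
    (R.toLinearEquiv : V →ₗ[ℝ] V) ![x, u, v]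
  rw [hR, one_mul] at this
  rw [trip_eq_det, trip_eq_det, ← this]
  congr 1
  funext i
  fin_cases i <;> rfl

/-- Only the components along e₀ and e₁ contribute; the factor is the orientation ±1 of the frame.
-/
theorem trip_row (g : G) (u v : V) : trip (row g 2) u v = trip (row g 2) (row g 0) (row g 1) *
    (inner ℝ (row g 0) u * inner ℝ (row g 1) v - inner ℝ (row g 1) u * inner ℝ (row g 0) v) := by
  have hu := sum_inner_row g u
  have hv := sum_inner_row g v
  rw [Fin.sum_univ_three] at hu hv
  generalize inner ℝ (row g 0) u = u0 at *
  generalize inner ℝ (row g 1) u = u1 at *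
  generalize inner ℝ (row g 2) u = u2 at *
  generalize inner ℝ (row g 0) v = v0 at *
  generalize inner ℝ (row g 1) v = v1 at *
  generalize inner ℝ (row g 2) v = v2 at *
  rw [← hu, ← hv]
  simp only [trip, PiLp.add_apply, PiLp.smul_apply, smul_eq_mul]
  ring

theorem trip_row_sq (g : G) : trip (row g 2) (row g 0) (row g 1) ^ 2 = 1 := by
  have h : trip (row g 2) (row g 0) (row g 1) = g.1.det := by
    rw [Matrix.det_fin_three]
    simp [trip]
    ring
  have := congrArg Matrix.det ((Matrix.mem_orthogonalGroup_iff _ _).1 g.2)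
  rw [Matrix.det_mul, Matrix.det_transpose, Matrix.det_one] at this
  rw [h, sq, this]

/-- Three vectors of the plane x^⊥ are linearly dependent. -/
theorem trip_eq_zero (x u v w : V) (hx : ‖x‖ = 1) (hu : inner ℝ x u = 0) (hv : inner ℝ x v = 0)
    (hw : inner ℝ x w = 0) : trip u v w = 0 := by
  obtain ⟨s, t, rfl⟩ := exists_frame_of_norm_eq_one hx
  set g := rotG (show (2 : Fin 3) ≠ 0 by decide) s * (rotG (show (0 : Fin 3) ≠ 1 by decide) t * 1)
  have hu' := sum_inner_row g u
  have hv' := sum_inner_row g v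
  have hw' := sum_inner_row g w
  rw [Fin.sum_univ_three] at hu' hv' hw'
  rw [hu, zero_smul, add_zero] at hu'
  rw [hv, zero_smul, add_zero] at hv'
  rw [hw, zero_smul, add_zero] at hw'
  generalize inner ℝ (row g 0) u = u0 at *
  generalize inner ℝ (row g 1) u = u1 at *
  generalize inner ℝ (row g 0) v = v0 at *
  generalize inner ℝ (row g 1) v = v1 at *
  generalize inner ℝ (row g 0) w = w0 at *
  generalize inner ℝ (row g 1) w = w1 at *
  rw [← hu', ← hv', ← hw']
  simp only [trip, PiLp.add_apply, PiLp.smul_apply, smul_eq_mul]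
  ring

/-! ### Pull-backs -/

/-- The base point is a variable p, so that an equality of points can be used without transport
between tangent spaces. -/
theorem pull_eq {k : ℕ} (σ : Form k) (t : Tor) (q : E) (hq : q.1 ≠ 0) {p : M}
    (hp : proj t q hq = p) : pull σ t q = (σ p).compContinuousLinearMap
      ((‖q.1‖⁻¹ • ((ℝ ∙ (p.1 : V))ᗮ).orthogonalProjectionOnto).prodMap
        (ContinuousLinearMap.id ℝ V)) := by
  subst hp
  exact pull_of_ne σ t hq

theorem pull_translate {k : ℕ} (σ : Form k) (t : Tor) (x y z : V) :
    pull σ t (x, y + z) = pull σ (t + torOf z) (x, y) := by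
  by_cases hx : x ≠ 0
  · have h : proj t (x, y + z) hx = proj (t + torOf z) (x, y) hx := by
      refine Prod.ext rfl ?_
      show t + torOf (y + z) = t + torOf z + torOf y
      rw [torOf_add]
      abel
    rw [pull_eq σ t (x, y + z) hx h, pull_eq σ _ (x, y) hx rfl]
  · simp only [pull, dif_neg hx]

theorem projDeriv_radial (t : Tor) (q : E) (hq : q.1 ≠ 0) : projDeriv t q hq (q.1, 0) = 0 := by
  have h : ((ℝ ∙ ((proj t q hq).1 : V))ᗮ).orthogonalProjectionOnto q.1 = 0 := by
    rw [Submodule.orthogonalProjectionOnto_eq_zero_iff, Submodule.orthogonal_orthogonal]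
    refine Submodule.mem_span_singleton.2 ⟨‖q.1‖, ?_⟩
    show ‖q.1‖ • ‖q.1‖⁻¹ • q.1 = q.1
    rw [smul_smul, mul_inv_cancel₀ (norm_ne_zero_iff.2 hq), one_smul]
  refine Prod.ext ?_ rfl
  show ‖q.1‖⁻¹ • ((ℝ ∙ ((proj t q hq).1 : V))ᗮ).orthogonalProjectionOnto q.1 = 0
  rw [h, smul_zero]

theorem pull_radial (σ : Form 2) (t : Tor) (q : E) (u : E) : pull σ t q ![(q.1, 0), u] = 0 := by
  by_cases hq : q.1 ≠ 0
  · rw [pull_of_ne σ t hq]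
    refine (σ (proj t q hq)).map_coord_zero (0 : Fin 2) ?_
    exact projDeriv_radial t q hq
  · simp [pull, hq]

/-- The first component of `projDeriv` differs from a multiple of the identity by a multiple
of `x`. -/
theorem exists_projDeriv (t : Tor) (q : E) (hq : q.1 ≠ 0) (u : E) : ∃ c : ℝ,
    incl _ (projDeriv t q hq u) = (‖q.1‖⁻¹ • u.1 + c • q.1, u.2) := by
  set W := ℝ ∙ ((proj t q hq).1 : V)
  have h : u.1 - ((Wᗮ).orthogonalProjectionOnto u.1 : V) ∈ W := by
    have := Submodule.sub_starProjection_mem_orthogonal (K := Wᗮ) u.1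
    rwa [Submodule.orthogonal_orthogonal] at this
  obtain ⟨c, hc⟩ := Submodule.mem_span_singleton.1 h
  refine ⟨-(‖q.1‖⁻¹ * (c * ‖q.1‖⁻¹)), Prod.ext ?_ rfl⟩
  show ‖q.1‖⁻¹ • ((Wᗮ).orthogonalProjectionOnto u.1 : V) = _
  have hc' : ((Wᗮ).orthogonalProjectionOnto u.1 : V) = u.1 - c • ‖q.1‖⁻¹ • q.1 := by
    change c • ‖q.1‖⁻¹ • q.1 = _ at hc
    rw [hc]
    abel
  rw [hc']
  module

/-! ### The explicit forms -/

theorem pull_theta (t : Tor) (q : E) (hq : q.1 ≠ 0) (v : Fin 1 → E) :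
    pull theta t q v = ‖q.1‖⁻¹ * inner ℝ q.1 (v 0).2 := by
  rw [pull_of_ne theta t hq]
  show (∑ i : Fin 3, (‖q.1‖⁻¹ • q.1) i • dy i) (incl _ (projDeriv t q hq (v 0))) = _
  have : (incl _ (projDeriv t q hq (v 0))).2 = (v 0).2 := rfl
  simp only [Fin.sum_univ_three, add_apply, smul_apply,
    PiLp.inner_apply, PiLp.smul_apply, smul_eq_mul, dy, ContinuousLinearMap.comp_apply,
    ContinuousLinearMap.coe_snd', this, EuclideanSpace.coe_proj, RCLike.inner_apply, conj_trivial]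
  ring

theorem gamma_aux (x : V) (v : Fin 2 → E) : (∑ i : Fin 3, x i •
    (wedge (oneForm (dx (i + 1))) (oneForm (dx (i + 2))) +
      wedge (oneForm (dy (i + 1))) (oneForm (dy (i + 2))))) v =
    trip x (v 0).2 (v 1).2 + trip x (v 0).1 (v 1).1 := by
  simp only [Fin.sum_univ_three, ContinuousAlternatingMap.add_apply,
    ContinuousAlternatingMap.smul_apply, wedge_one_one, smul_eq_mul, dx, dy,
    ContinuousLinearMap.comp_apply, ContinuousLinearMap.coe_snd', ContinuousLinearMap.coe_fst',
    EuclideanSpace.coe_proj, trip]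
  simp only [show (0 : Fin 3) + 1 = 1 from rfl, show (0 : Fin 3) + 2 = 2 from rfl,
    show (1 : Fin 3) + 1 = 2 from rfl, show (1 : Fin 3) + 2 = 0 from rfl,
    show (2 : Fin 3) + 1 = 0 from rfl, show (2 : Fin 3) + 2 = 1 from rfl]
  ring

theorem gamma_apply (p : M) (v : Fin 2 → TM p) :
    gamma p v = trip p.1 (v 0).2 (v 1).2 + trip p.1 (v 0).1 (v 1).1 :=
  gamma_aux _ _

/-- Normalising x gives one factor |x|⁻¹; each of the two sphere directions gives another. The
radial corrections of `exists_projDeriv` drop out of a triple product with x. -/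
theorem pull_gamma (t : Tor) (q : E) (hq : q.1 ≠ 0) (v : Fin 2 → E) :
    pull gamma t q v = ‖q.1‖⁻¹ * trip q.1 (v 0).2 (v 1).2 +
      ‖q.1‖⁻¹ ^ 3 * trip q.1 (v 0).1 (v 1).1 := by
  rw [pull_of_ne gamma t hq]
  refine (gamma_aux (‖q.1‖⁻¹ • q.1) fun i => incl _ (projDeriv t q hq (v i))).trans ?_
  obtain ⟨a, ha⟩ := exists_projDeriv t q hq (v 0)
  obtain ⟨b, hb⟩ := exists_projDeriv t q hq (v 1)
  rw [ha, hb]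
  simp only [trip, PiLp.add_apply, PiLp.smul_apply, smul_eq_mul]
  ring

theorem alpha_beta_aux (x : V) (u v : E) :
    psi ![(0, x), u, v] = trip x u.2 v.2 - trip x u.1 v.1 ∧
      psiTilde ![(0, x), u, v] = -(trip x u.1 v.2 + trip x u.2 v.1) := by
  have h : holForm ![(0, x), u, v] = ⟨trip x u.2 v.2 - trip x u.1 v.1,
      -(trip x u.1 v.2 + trip x u.2 v.1)⟩ := by
    simp only [holForm, ContinuousAlternatingMap.smul_apply, wedge_two_one, wedge_one_one]
    simp only [dz, dx, dy, Matrix.cons_val_zero, Matrix.cons_val_one, Matrix.cons_val,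
      add_apply, smul_apply,
      ContinuousLinearMap.comp_apply, ContinuousLinearMap.coe_snd', ContinuousLinearMap.coe_fst',
      EuclideanSpace.coe_proj, Complex.ofRealCLM_apply]
    apply Complex.ext
    · simp [trip]
      ring
    · simp [trip]
      ring
  exact ⟨congrArg Complex.re h, congrArg Complex.im h⟩

theorem alpha_apply (p : M) (u v : TM p) :
    alpha p ![u, v] = trip p.1 u.2 v.2 - trip p.1 u.1 v.1 := by
  refine Eq.trans ?_ (alpha_beta_aux p.1 (incl p u) (incl p v)).1
  refine congrArg psi ?_
  funext i
  fin_cases i <;> rfl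

theorem beta_apply (p : M) (u v : TM p) :
    beta p ![u, v] = -(trip p.1 u.1 v.2 + trip p.1 u.2 v.1) := by
  refine Eq.trans ?_ (alpha_beta_aux p.1 (incl p u) (incl p v)).2
  refine congrArg psiTilde ?_
  funext i
  fin_cases i <;> rfl

/-! ### Smoothness and derivatives -/

theorem contDiffOn_inv_norm : ContDiffOn ℝ ∞ (fun q : E => ‖q.1‖⁻¹) {q : E | q.1 ≠ 0} := by
  intro q hq
  refine ContDiffAt.contDiffWithinAt ?_
  exact (contDiffAt_fst.norm ℝ hq).inv (norm_ne_zero_iff.2 hq)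

theorem contDiff_fst_apply (i : Fin 3) : ContDiff ℝ ∞ (fun q : E => q.1 i) := (dx i).contDiff

theorem isSmooth_theta : IsSmooth theta := by
  intro t
  have h : ContDiffOn ℝ ∞ (fun q : E => ∑ i : Fin 3, (‖q.1‖⁻¹ * q.1 i) • oneForm (dy i))
      {q : E | q.1 ≠ 0} :=
    ContDiffOn.sum fun i _ =>
      (contDiffOn_inv_norm.mul (contDiff_fst_apply i).contDiffOn).smul contDiffOn_const
  refine h.congr fun q hq => ?_
  ext v
  rw [pull_theta t q hq]
  simp only [Fin.sum_univ_three, ContinuousAlternatingMap.add_apply,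
    ContinuousAlternatingMap.smul_apply, oneForm_apply, PiLp.inner_apply, smul_eq_mul, dy,
    ContinuousLinearMap.comp_apply, ContinuousLinearMap.coe_snd', EuclideanSpace.coe_proj,
    RCLike.inner_apply, conj_trivial]
  ring

theorem isSmooth_gamma : IsSmooth gamma := by
  intro t
  have h : ContDiffOn ℝ ∞ (fun q : E => ∑ i : Fin 3,
      ((‖q.1‖⁻¹ * q.1 i) • wedge (oneForm (dy (i + 1))) (oneForm (dy (i + 2))) +
      (‖q.1‖⁻¹ ^ 3 * q.1 i) • wedge (oneForm (dx (i + 1))) (oneForm (dx (i + 2)))))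
      {q : E | q.1 ≠ 0} :=
    ContDiffOn.sum fun i _ =>
      ((contDiffOn_inv_norm.mul (contDiff_fst_apply i).contDiffOn).smul contDiffOn_const).add
      (((contDiffOn_inv_norm.pow 3).mul (contDiff_fst_apply i).contDiffOn).smul contDiffOn_const)
  refine h.congr fun q hq => ?_
  ext v
  rw [pull_gamma t q hq]
  simp only [Fin.sum_univ_three, ContinuousAlternatingMap.add_apply,
    ContinuousAlternatingMap.smul_apply, wedge_one_one, smul_eq_mul, dx, dy,
    ContinuousLinearMap.comp_apply, ContinuousLinearMap.coe_snd', ContinuousLinearMap.coe_fst',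
    EuclideanSpace.coe_proj, trip]
  simp only [show (0 : Fin 3) + 1 = 1 from rfl, show (0 : Fin 3) + 2 = 2 from rfl,
    show (1 : Fin 3) + 1 = 2 from rfl, show (1 : Fin 3) + 2 = 0 from rfl,
    show (2 : Fin 3) + 1 = 0 from rfl, show (2 : Fin 3) + 2 = 1 from rfl]
  ring

theorem add_smul_ne_zero {x w : V} (hx : ‖x‖ = 1) (hw : inner ℝ x w = 0) (s : ℝ) :
    x + s • w ≠ 0 := by
  intro h
  have : inner ℝ x (x + s • w) = 1 := by
    rw [inner_add_right, inner_smul_right, hw, real_inner_self_eq_norm_sq, hx]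
    norm_num
  rw [h, inner_zero_right] at this
  exact zero_ne_one this

theorem hasDerivAt_inv_norm {x w : V} (hx : ‖x‖ = 1) (hw : inner ℝ x w = 0) :
    HasDerivAt (fun s : ℝ => ‖x + s • w‖⁻¹) 0 0 := by
  have h1 : HasDerivAt (fun s : ℝ => x + s • w) w 0 := by
    simpa using ((hasDerivAt_id (0 : ℝ)).smul_const w).const_add x
  have h2 := h1.norm_sq
  have h3 := (h2.sqrt (by simp [hx])).inv (by simp [hx])
  -- The norm is differentiated as the root of its square, whose derivative 2⟨x, w⟩ vanishes for
  -- tangential w.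
  have h4 : (fun s : ℝ => ‖x + s • w‖⁻¹) = (fun s => √(‖x + s • w‖ ^ 2))⁻¹ := by
    funext s
    simp
  rw [h4]
  refine h3.congr_deriv ?_
  simp [hw]

theorem fderiv_eq_of_line {f : E → ℝ} {q w : E} {d : ℝ} (hf : DifferentiableAt ℝ f q)
    (h : HasDerivAt (fun s : ℝ => f (q + s • w)) d 0) : fderiv ℝ f q w = d :=
  hf.lineDeriv_eq_fderiv.symm.trans h.deriv

theorem inner_tangent (p : M) (u : TM p) : inner ℝ (p.1 : V) (u.1 : V) = 0 :=
  Submodule.mem_orthogonal_singleton_iff_inner_right.1 u.1.2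

theorem norm_point (p : M) : ‖(p.1 : V)‖ = 1 := by simp

theorem fderiv_pull_theta (p : M) (w : E) (hw : inner ℝ (p.1 : V) w.1 = 0) (v : Fin 1 → E) :
    fderiv ℝ (fun q => pull theta p.2 q v) ((p.1 : V), 0) w = inner ℝ w.1 (v 0).2 := by
  refine fderiv_eq_of_line
    ((isSmooth_theta.differentiableAt p).continuousAlternatingMap_apply_const v) ?_
  have h : (fun s : ℝ => pull theta p.2 (((p.1 : V), (0 : V)) + s • w) v) =
      fun s : ℝ => ‖(p.1 : V) + s • w.1‖⁻¹ *
        (inner ℝ (p.1 : V) (v 0).2 + s * inner ℝ w.1 (v 0).2) := by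
    funext s
    rw [pull_theta _ _ (add_smul_ne_zero (norm_point p) hw s)]
    simp [inner_add_left, inner_smul_left]
  rw [h]
  have := (hasDerivAt_inv_norm (norm_point p) hw).mul
    (((hasDerivAt_id (0 : ℝ)).mul_const (inner ℝ w.1 (v 0).2)).const_add
      (inner ℝ (p.1 : V) (v 0).2))
  refine this.congr_deriv ?_
  simp [norm_point p]

theorem fderiv_pull_gamma (p : M) (w : E) (hw : inner ℝ (p.1 : V) w.1 = 0) (v : Fin 2 → E) :
    fderiv ℝ (fun q => pull gamma p.2 q v) ((p.1 : V), 0) w =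
      trip w.1 (v 0).2 (v 1).2 + trip w.1 (v 0).1 (v 1).1 := by
  refine fderiv_eq_of_line
    ((isSmooth_gamma.differentiableAt p).continuousAlternatingMap_apply_const v) ?_
  have ht : ∀ (a b : V) (s : ℝ), trip ((p.1 : V) + s • w.1) a b =
      trip p.1 a b + s * trip w.1 a b := by
    intro a b s
    simp only [trip, PiLp.add_apply, PiLp.smul_apply, smul_eq_mul]
    ring
  have h : (fun s : ℝ => pull gamma p.2 (((p.1 : V), (0 : V)) + s • w) v) =
      fun s : ℝ => ‖(p.1 : V) + s • w.1‖⁻¹ *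
        (trip p.1 (v 0).2 (v 1).2 + s * trip w.1 (v 0).2 (v 1).2) +
        ‖(p.1 : V) + s • w.1‖⁻¹ ^ 3 *
        (trip p.1 (v 0).1 (v 1).1 + s * trip w.1 (v 0).1 (v 1).1) := by
    funext s
    rw [pull_gamma _ _ (add_smul_ne_zero (norm_point p) hw s), ← ht, ← ht]
    rfl
  rw [h]
  have hn := hasDerivAt_inv_norm (norm_point p) hw
  have := (hn.mul (((hasDerivAt_id (0 : ℝ)).mul_const (trip w.1 (v 0).2 (v 1).2)).const_add
      (trip p.1 (v 0).2 (v 1).2))).add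
    ((hn.pow 3).mul (((hasDerivAt_id (0 : ℝ)).mul_const (trip w.1 (v 0).1 (v 1).1)).const_add
      (trip p.1 (v 0).1 (v 1).1)))
  refine this.congr_deriv ?_
  simp [norm_point p]

theorem omega_apply (p : M) (u v : TM p) :
    omega p ![u, v] = inner ℝ (u.1 : V) v.2 - inner ℝ (v.1 : V) u.2 := by
  show extDeriv (pull theta p.2) ((p.1 : V), 0) (incl p ∘ ![u, v]) = _
  rw [extDeriv_apply (isSmooth_theta.differentiableAt p), Fin.sum_univ_two,
    fderiv_pull_theta p _ (inner_tangent p u), fderiv_pull_theta p _ (inner_tangent p v)]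
  simp [incl, Fin.removeNth, sub_eq_add_neg]

/-! ### The form `γ` lies in `ℋ_M` -/

/-- Every point of `S²` is the last vector of an orthonormal frame. -/
theorem exists_row_eq (p : M) : ∃ g : G, row g 2 = p.1 := by
  obtain ⟨s, t, h⟩ := exists_frame_of_norm_eq_one (norm_point p)
  exact ⟨_, h⟩

theorem gamma_mem_OmegaMinus : gamma ∈ OmegaMinus := by
  refine ⟨isSmooth_gamma, ?_, fun p => ?_⟩
  · funext p
    ext v
    show gamma p (Matrix.vecCons (reeb p) v) = 0
    rw [gamma_apply]
    simp only [trip, reeb, Matrix.cons_val_zero]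
    simp
    ring
  · obtain ⟨g, hg⟩ := exists_row_eq p
    -- In frame coordinates the triple product and the inner product become polynomials, and the
    -- three wedge products vanish identically, whatever δ is.
    have hi : ∀ u : TM p, ∀ b : V, inner ℝ (u.1 : V) b =
        inner ℝ (row g 0) (u.1 : V) * inner ℝ (row g 0) b +
        inner ℝ (row g 1) (u.1 : V) * inner ℝ (row g 1) b := by
      intro u b
      have h := sum_inner_row g (u.1 : V)
      rw [Fin.sum_univ_three, hg, inner_tangent, zero_smul, add_zero] at h
      nth_rewrite 1 [← h]
      rw [inner_add_left, real_inner_smul_left, real_inner_smul_left]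
    obtain ⟨δ, ht⟩ : ∃ δ, ∀ u v : V, trip p.1 u v = δ * (inner ℝ (row g 0) u *
        inner ℝ (row g 1) v - inner ℝ (row g 1) u * inner ℝ (row g 0) v) :=
      ⟨_, fun u v => hg ▸ trip_row g u v⟩
    refine ⟨?_, ?_, ?_⟩ <;> ext v <;> rw [wedge_two_two] <;>
      change _ = (0 : ℝ) <;> simp only [gamma_apply, omega_apply, alpha_apply, beta_apply, ht, hi,
        Matrix.cons_val_zero, Matrix.cons_val_one] <;> ring

theorem thetaL_apply (p : M) (u : TM p) : thetaL p u = inner ℝ (p.1 : V) u.2 := by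
  simp [thetaL, incl, dy, Fin.sum_univ_three, PiLp.inner_apply, mul_comm]

theorem inner_projH (p : M) (u : TM p) : inner ℝ (p.1 : V) (projH p u).1 = 0 ∧
    inner ℝ (p.1 : V) (projH p u).2 = 0 := by
  refine ⟨inner_tangent p _, ?_⟩
  have : (projH p u).2 = u.2 - inner ℝ (p.1 : V) u.2 • (p.1 : V) := by
    rw [← thetaL_apply]
    rfl
  rw [this, inner_sub_right, inner_smul_right, real_inner_self_eq_norm_sq, norm_point]
  ring

/-- Each term of the exterior derivative on H is a sum of triple products of vectors orthogonal to
x. -/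
theorem dH_gamma : dH gamma = 0 := by
  funext p
  ext v
  show extDeriv (pull gamma p.2) ((p.1 : V), 0) (fun i => incl p (projH p (v i))) = 0
  rw [extDeriv_apply (isSmooth_gamma.differentiableAt p)]
  refine Finset.sum_eq_zero fun i _ => ?_
  rw [fderiv_pull_gamma p _ (inner_projH p (v i)).1]
  have h := fun i => inner_projH p (v i)
  have h1 : ∀ i j k, trip (projH p (v i)).1 (projH p (v j)).2 (projH p (v k)).2 = 0 :=
    fun i j k => trip_eq_zero p.1 _ _ _ (norm_point p) (h i).1 (h j).2 (h k).2
  have h2 : ∀ i j k, trip (projH p (v i)).1 (projH p (v j)).1 (projH p (v k)).1 = 0 :=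
    fun i j k => trip_eq_zero p.1 _ _ _ (norm_point p) (h i).1 (h j).1 (h k).1
  have h3 := (congrArg₂ (· + ·) (h1 i (i.succAbove 0) (i.succAbove 1))
    (h2 i (i.succAbove 0) (i.succAbove 1))).trans (add_zero 0)
  exact (congrArg _ h3).trans (smul_zero _)

theorem gamma_mem_HM : gamma ∈ HM := ⟨gamma_mem_OmegaMinus, dH_gamma⟩

theorem isSO3Invariant_gamma : IsSO3Invariant gamma := by
  intro R hR q hq
  have hq' : (diagAct R q).1 ≠ 0 := by
    show R q.1 ≠ 0
    simpa using hq
  ext v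
  rw [ContinuousAlternatingMap.compContinuousLinearMap_apply, pull_gamma 0 _ hq',
    pull_gamma 0 q hq]
  show ‖R q.1‖⁻¹ * trip (R q.1) (R (v 0).2) (R (v 1).2) +
    ‖R q.1‖⁻¹ ^ 3 * trip (R q.1) (R (v 0).1) (R (v 1).1) = _
  rw [trip_map R hR, trip_map R hR, R.norm_map]

/-! ### Components of a form with respect to frames -/

def framePt (g : G) (t : Tor) : M := (⟨row g 2, by simpa using norm_row g 2⟩, t)

theorem row_mem (g : G) {i : Fin 3} (hi : i ≠ 2) : row g i ∈ (ℝ ∙ row g 2)ᗮ := by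
  rw [Submodule.mem_orthogonal_singleton_iff_inner_right, inner_row, if_neg hi.symm]

/-- The tangent vector `e_i` to `S²`. -/
def vecA (g : G) (t : Tor) (i : Fin 3) (hi : i ≠ 2 := by decide) : TM (framePt g t) :=
  (⟨row g i, row_mem g hi⟩, 0)

/-- The tangent vector `e_i` to `T³`. -/
def vecB (g : G) (t : Tor) (i : Fin 3) : TM (framePt g t) := (0, row g i)

/-- At a point of the unit sphere, the pull-back of a form restricts to this form. -/
theorem pull_comp_incl {k : ℕ} (σ : Form k) (g : G) (y : V) :
    (pull σ 0 (row g 2, y)).compContinuousLinearMap (incl (framePt g (torOf y))) =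
      σ (framePt g (torOf y)) := by
  have hp : proj 0 (row g 2, y) (row_ne_zero g 2) = framePt g (torOf y) := by
    refine Prod.ext (Subtype.ext ?_) ?_
    · show ‖row g 2‖⁻¹ • row g 2 = row g 2
      rw [norm_row, inv_one, one_smul]
    · show 0 + torOf y = torOf y
      rw [zero_add]
  rw [pull_eq σ 0 (row g 2, y) (row_ne_zero g 2) hp]
  ext v
  refine congrArg (σ (framePt g (torOf y))) ?_
  funext i
  refine Prod.ext ?_ rfl
  show ‖row g 2‖⁻¹ • ((ℝ ∙ row g 2)ᗮ).orthogonalProjectionOnto ((v i).1 : V) = (v i).1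
  rw [norm_row, inv_one, one_smul]
  exact Submodule.orthogonalProjectionOnto_mem_subspace_eq_self _

theorem bil_pull (σ : Form 2) (g : G) (y : V) (u v : TM (framePt g (torOf y))) :
    bil (pull σ 0 (row g 2, y)) (incl _ u) (incl _ v) = σ (framePt g (torOf y)) ![u, v] := by
  rw [bil_apply, ← pull_comp_incl σ g y]
  refine congrArg (pull σ 0 (row g 2, y)) ?_
  funext i
  fin_cases i <;> rfl

theorem reeb_left {σ : Form 2} (h : IsHorizontal σ) (p : M) (u : TM p) :
    σ p ![reeb p, u] = 0 :=
  congrArg (fun τ : TM p [⋀^Fin 1]→L[ℝ] ℝ => τ ![u]) (congrFun h p)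

theorem reeb_right {σ : Form 2} (h : IsHorizontal σ) (p : M) (u : TM p) :
    σ p ![u, reeb p] = 0 := by rw [alt_swap, reeb_left h, neg_zero]

theorem bil_swap (a : E [⋀^Fin 2]→L[ℝ] ℝ) (u v : E) : bil a u v = -bil a v u := by
  rw [bil_apply, bil_apply, alt_swap]

/-- The algebraic properties of the value of an anti-self-dual form. -/
theorem asd_relations {σ : Form 2} (hσ : σ ∈ OmegaMinus) (g : G) (t : Tor) :
    σ (framePt g t) ![vecA g t 0, vecA g t 1] = σ (framePt g t) ![vecB g t 0, vecB g t 1] ∧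
    σ (framePt g t) ![vecA g t 1, vecB g t 1] = -σ (framePt g t) ![vecA g t 0, vecB g t 0] ∧
    σ (framePt g t) ![vecA g t 1, vecB g t 0] = σ (framePt g t) ![vecA g t 0, vecB g t 1] := by
  obtain ⟨h1, h2, h3⟩ := hσ.2.2 (framePt g t)
  -- Each wedge product is evaluated on (A₀, A₁, B₀, B₁): ω relates the values on (A_i, B_i), α
  -- those on (A₀, A₁) and (B₀, B₁), β the mixed ones.
  have key : ∀ b : TM (framePt g t) [⋀^Fin 2]→L[ℝ] ℝ, wedge (σ (framePt g t)) b = 0 → _ :=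
    fun b hb => (wedge_two_two (σ (framePt g t)) b
      ![vecA g t 0, vecA g t 1, vecB g t 0, vecB g t 1]).symm.trans
      (congrArg (fun τ : TM (framePt g t) [⋀^Fin 4]→L[ℝ] ℝ =>
        τ ![vecA g t 0, vecA g t 1, vecB g t 0, vecB g t 1]) hb)
  have k1 := key _ h1
  have k2 := key _ h2
  have k3 := key _ h3
  have hδ := trip_row_sq g
  have ht : ∀ u v : V, trip (framePt g t).1 u v = _ := trip_row g
  have hA : ∀ i (hi : i ≠ 2), ((vecA g t i hi).1 : V) = row g i := fun _ _ => rfl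
  have hA' : ∀ i (hi : i ≠ 2), (vecA g t i hi).2 = 0 := fun _ _ => rfl
  have hB : ∀ i, ((vecB g t i).1 : V) = 0 := fun _ => rfl
  have hB' : ∀ i, (vecB g t i).2 = row g i := fun _ => rfl
  generalize hd : trip (row g 2) (row g 0) (row g 1) = δ at *
  have hδ0 : δ ≠ 0 := by
    rintro rfl
    norm_num at hδ
  simp [omega_apply, alpha_apply, beta_apply, hA, hA', hB, hB', ht, inner_row, norm_row] at k1 k2 k3
  refine ⟨?_, ?_, ?_⟩
  · refine mul_right_cancel₀ hδ0 ?_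
    linarith
  · linarith
  · refine mul_right_cancel₀ hδ0 ?_
    linarith

/-- A horizontal form is determined by its values on the frame vectors of the contact
distribution. -/
theorem eq_zero_of_frame {σ : Form 2} (h : IsHorizontal σ) (g : G) (t : Tor)
    (h1 : σ (framePt g t) ![vecA g t 0, vecA g t 1] = 0)
    (h2 : σ (framePt g t) ![vecB g t 0, vecB g t 1] = 0)
    (h3 : σ (framePt g t) ![vecA g t 0, vecB g t 0] = 0)
    (h4 : σ (framePt g t) ![vecA g t 0, vecB g t 1] = 0)
    (h5 : σ (framePt g t) ![vecA g t 1, vecB g t 0] = 0)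
    (h6 : σ (framePt g t) ![vecA g t 1, vecB g t 1] = 0) : σ (framePt g t) = 0 := by
  have hr := reeb_left h (framePt g t)
  have hr' := reeb_right h (framePt g t)
  set τ := σ (framePt g t)
  have hs := alt_swap τ
  have h0 : ∀ u, τ ![u, u] = 0 := fun u =>
    τ.map_eq_zero_of_eq ![u, u] (i := 0) (j := 1) rfl (by decide)
  have hexp : ∀ u : TM (framePt g t), ∃ a b c d e : ℝ, u = a • vecA g t 0 + b • vecA g t 1 +
      c • vecB g t 0 + d • vecB g t 1 + e • reeb (framePt g t) := by
    intro u
    have e1 := sum_inner_row g (u.1 : V)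
    have e2 := sum_inner_row g u.2
    have e3 : inner ℝ (row g 2) (u.1 : V) = 0 := inner_tangent (framePt g t) u
    rw [Fin.sum_univ_three] at e1 e2
    rw [e3, zero_smul, add_zero] at e1
    refine ⟨inner ℝ (row g 0) (u.1 : V), inner ℝ (row g 1) (u.1 : V), inner ℝ (row g 0) u.2,
      inner ℝ (row g 1) u.2, inner ℝ (row g 2) u.2, Prod.ext (Subtype.ext (e1.symm.trans ?_)) (e2.symm.trans ?_)⟩
    · show _ = inner ℝ (row g 0) (u.1 : V) • row g 0 + inner ℝ (row g 1) (u.1 : V) • row g 1 +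
        inner ℝ (row g 0) u.2 • (0 : V) + inner ℝ (row g 1) u.2 • (0 : V) +
        inner ℝ (row g 2) u.2 • (0 : V)
      simp
    · show _ = inner ℝ (row g 0) (u.1 : V) • (0 : V) + inner ℝ (row g 1) (u.1 : V) • (0 : V) +
        inner ℝ (row g 0) u.2 • row g 0 + inner ℝ (row g 1) u.2 • row g 1 +
        inner ℝ (row g 2) u.2 • row g 2
      simp
  have hb : ∀ u v, bil τ u v = 0 := by
    intro u v
    obtain ⟨a, b, c, d, e, hu⟩ := hexp u
    obtain ⟨a', b', c', d', e', hv⟩ := hexp v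
    rw [hu, hv]
    simp only [map_add, map_smul, add_apply, smul_apply, bil_apply, hr, hr', h0, h1, h2, h3, h4, h5,
      h6, hs (vecA g t 0) (vecA g t 1), hs (vecB g t 0) (vecB g t 1), hs (vecA g t 0) (vecB g t 0),
      hs (vecA g t 0) (vecB g t 1), hs (vecA g t 1) (vecB g t 0), hs (vecA g t 1) (vecB g t 1),
      neg_zero, smul_zero, add_zero]
  ext v
  have : ![v 0, v 1] = v := by
    funext i
    fin_cases i <;> rfl
  rw [← this, ← bil_apply, hb]
  rfl

/-! ### The components as functions on the space of frames -/

/-- The base point of a triple of vectors. -/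
def base : N →L[ℝ] E :=
  ((ContinuousLinearMap.proj 2).comp (ContinuousLinearMap.fst ℝ (Fin 3 → V) V)).prod
    (ContinuousLinearMap.snd ℝ (Fin 3 → V) V)

def toX (i : Fin 3) : N →L[ℝ] E :=
  ((ContinuousLinearMap.proj i).comp (ContinuousLinearMap.fst ℝ (Fin 3 → V) V)).prod 0

def toY (i : Fin 3) : N →L[ℝ] E :=
  (0 : N →L[ℝ] V).prod ((ContinuousLinearMap.proj i).comp (ContinuousLinearMap.fst ℝ (Fin 3 → V) V))

theorem base_apply (n : N) : base n = (n.1 2, n.2) := rfl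
theorem toX_apply (i : Fin 3) (n : N) : toX i n = (n.1 i, 0) := rfl
theorem toY_apply (i : Fin 3) (n : N) : toY i n = (0, n.1 i) := rfl

/-- The value of a form on two of the vectors of a frame. -/
def comp (σ : Form 2) (a b : N →L[ℝ] E) (n : N) : ℝ := bil (pull σ 0 (base n)) (a n) (b n)

theorem contDiffOn_bil_pull {σ : Form 2} (h : IsSmooth σ) :
    ContDiffOn ℝ ∞ (fun q => bil (pull σ 0 q)) {q : E | q.1 ≠ 0} :=
  contDiffOn_bil (h 0)

theorem isGood_comp {σ : Form 2} (h : IsSmooth σ) {a b : N →L[ℝ] E}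
    (ha : ∀ n l, a (n.1, n.2 + l) = a n) (hb : ∀ n l, b (n.1, n.2 + l) = b n) :
    IsGood (comp σ a b) where
  contDiffOn :=
    (((contDiffOn_bil_pull h).comp base.contDiff.contDiffOn fun _ hn => hn).clm_apply
      a.contDiff.contDiffOn).clm_apply b.contDiff.contDiffOn
  periodic n l hl := by
    have : pull σ 0 (base (n.1, n.2 + l)) = pull σ 0 (base n) := by
      simp only [base_apply]
      rw [pull_translate, hl, add_zero]
    simp only [comp, ha, hb, this]

theorem lieD_comp {σ : Form 2} (h : IsSmooth σ) (a b : N →L[ℝ] E) (A : N →L[ℝ] N) {n : N} (hn : n ∈ dom) :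
    lieD A (comp σ a b) n =
      fderiv ℝ (fun q => bil (pull σ 0 q)) (base n) (base (A n)) (a n) (b n) +
      bil (pull σ 0 (base n)) (a (A n)) (b n) + bil (pull σ 0 (base n)) (a n) (b (A n)) := by
  have hd : DifferentiableAt ℝ (fun q => bil (pull σ 0 q)) (base n) :=
    ((contDiffOn_bil_pull h).contDiffAt
      ((isOpen_ne_fun continuous_fst continuous_const).mem_nhds hn)).differentiableAt (by simp)
  exact fderiv_bil_apply base a b hd (A n)

/-- The equation `d_H σ = 0` on vectors of the contact distribution. -/
theorem closed_relation {σ : Form 2} (hσ : σ ∈ HM) (g : G) (y : V)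
    (u : Fin 3 → TM (framePt g (torOf y))) (hu : ∀ i, inner ℝ (row g 2) (u i).2 = 0) :
    fderiv ℝ (fun q => bil (pull σ 0 q)) (row g 2, y) (incl _ (u 0)) (incl _ (u 1)) (incl _ (u 2)) -
    fderiv ℝ (fun q => bil (pull σ 0 q)) (row g 2, y) (incl _ (u 1)) (incl _ (u 0)) (incl _ (u 2)) +
    fderiv ℝ (fun q => bil (pull σ 0 q)) (row g 2, y) (incl _ (u 2)) (incl _ (u 0)) (incl _ (u 1))
      = 0 := by
  have hs := hσ.1.1
  have hproj : ∀ i, projH _ (u i) = u i := by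
    intro i
    have h : thetaL _ (u i) = inner ℝ (row g 2) (u i).2 := thetaL_apply _ _
    have : projH _ (u i) = u i - thetaL _ (u i) • reeb _ := rfl
    rw [this, h, hu, zero_smul, sub_zero]
  have h0 : extDeriv (pull σ (torOf y)) (row g 2, 0) (fun i => incl _ (projH _ (u i))) = 0 :=
    congrArg (fun τ : TM (framePt g (torOf y)) [⋀^Fin 3]→L[ℝ] ℝ => τ u) (congrFun hσ.2 (framePt g (torOf y)))
  simp only [hproj] at h0
  -- `extD` uses the pull-back based at the point itself; a translation by y moves it to the fixed
  -- base point 0.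
  have hpull : pull σ (torOf y) = fun q => pull σ 0 (q + (0, y)) := by
    funext q
    have : q + (0, y) = (q.1, q.2 + y) := by ext <;> simp
    rw [this, pull_translate, zero_add]
  have hd : DifferentiableAt ℝ (fun q => bil (pull σ 0 q)) (row g 2, y) :=
    ((contDiffOn_bil_pull hs).contDiffAt
      ((isOpen_ne_fun continuous_fst continuous_const).mem_nhds (row_ne_zero g 2))).differentiableAt
      (by simp)
  have hD : ∀ (w : E) (v : Fin 2 → E), fderiv ℝ (fun q => pull σ (torOf y) q v) (row g 2, 0) w =
      fderiv ℝ (fun q => bil (pull σ 0 q)) (row g 2, y) w (v 0) (v 1) := by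
    intro w v
    have hv : ![v 0, v 1] = v := by
      funext i
      fin_cases i <;> rfl
    have e1 : (fun q => pull σ (torOf y) q v) =
        fun q => (fun q => bil (pull σ 0 q) (v 0) (v 1)) (q + (0, y)) := by
      funext q
      rw [hpull]
      simp only [bil_apply, hv]
    have e2 : (row g 2, (0 : V)) + (0, y) = (row g 2, y) := by
      ext <;> simp
    have e3 := fderiv_comp_add_right (𝕜 := ℝ) (f := fun q => bil (pull σ 0 q) (v 0) (v 1))
      (x := (row g 2, (0 : V))) ((0, y) : E)
    rw [e1, e3, e2]
    exact fderiv_bil_apply_const hd (v 0) (v 1) w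
  have hdiff : DifferentiableAt ℝ (pull σ (torOf y)) (row g 2, 0) :=
    hs.differentiableAt (framePt g (torOf y))
  rw [extDeriv_apply hdiff, Fin.sum_univ_three, hD, hD, hD] at h0
  simp [Fin.removeNth] at h0
  rw [sub_eq_add_neg]
  exact h0

/-- The first two vectors of a frame, as tangent vectors to `S²` or to `T³`. -/
inductive IsFrameVector : (N →L[ℝ] E) → Prop
  | x {i : Fin 3} (hi : i ≠ 2) : IsFrameVector (toX i)
  | y {i : Fin 3} (hi : i ≠ 2) : IsFrameVector (toY i)

namespace IsFrameVector

theorem periodic {c : N →L[ℝ] E} (hc : IsFrameVector c) (n : N) (l : V) :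
    c (n.1, n.2 + l) = c n := by
  cases hc <;> rfl

theorem exists_incl {c : N →L[ℝ] E} (hc : IsFrameVector c) (g : G) (y : V) :
    ∃ u : TM (framePt g (torOf y)), c (frame g y) = incl _ u ∧ inner ℝ (row g 2) u.2 = 0 := by
  cases hc with
  | x hi => exact ⟨vecA g _ _ hi, rfl, inner_zero_right _⟩
  | y hi => exact ⟨vecB g _ _, rfl, (inner_row g 2 _).trans (if_neg hi.symm)⟩

theorem apply_rot {c : N →L[ℝ] E} (hc : IsFrameVector c) (g : G) (y : V) (a : Fin 3) :
    ∃ k : ℝ, c (rotField 2 a (frame g y)) = k • (row g 2, (0 : V)) ∨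
      c (rotField 2 a (frame g y)) = k • ((0 : V), row g 2) := by
  cases hc with
  | @x i hi =>
    by_cases h : i = a
    · subst h
      exact ⟨-1, Or.inl (by simp [toX_apply, rotField_apply, hi, frame])⟩
    · exact ⟨0, Or.inl (by simp [toX_apply, rotField_apply, hi, h])⟩
  | @y i hi =>
    by_cases h : i = a
    · subst h
      exact ⟨-1, Or.inr (by simp [toY_apply, rotField_apply, hi, frame])⟩
    · exact ⟨0, Or.inr (by simp [toY_apply, rotField_apply, hi, h])⟩

theorem bil_rot {σ : Form 2} (hσ : IsHorizontal σ) {c d : N →L[ℝ] E} (hc : IsFrameVector c)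
    (hd : IsFrameVector d) (g : G) (y : V) (a : Fin 3) :
    bil (pull σ 0 (row g 2, y)) (c (rotField 2 a (frame g y))) (d (frame g y)) = 0 := by
  obtain ⟨k, h | h⟩ := hc.apply_rot g y a
  · rw [h, map_smul, smul_apply, bil_apply, pull_radial σ 0 (row g 2, y), smul_zero]
  · obtain ⟨u, hu, -⟩ := hd.exists_incl g y
    have : bil (pull σ 0 (row g 2, y)) (0, row g 2) (incl _ u) = 0 :=
      (bil_pull σ g y (reeb _) u).trans (reeb_left hσ _ u)
    rw [h, map_smul, smul_apply, hu, this, smul_zero]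

end IsFrameVector

/-! ### From closedness to the first order system -/

section Components

variable {σ : Form 2}

theorem IsFrameVector.isGood_comp (h : IsSmooth σ) {c d : N →L[ℝ] E} (hc : IsFrameVector c)
    (hd : IsFrameVector d) : IsGood (comp σ c d) :=
  CYBoundary.isGood_comp h hc.periodic hd.periodic

/-- Turning e₂ towards e_a also moves e_a, but by a multiple of e₂. The resulting terms vanish: (x,
0) is killed by the pull-back and (0, x) by horizontality. -/
theorem lieD_rot_comp (hs : IsSmooth σ) (hσ : IsHorizontal σ) {c d : N →L[ℝ] E}
    (hc : IsFrameVector c) (hd : IsFrameVector d) (a : Fin 3) (g : G) (y : V) :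
    lieD (rotField 2 a) (comp σ c d) (frame g y) =
      fderiv ℝ (fun q => bil (pull σ 0 q)) (row g 2, y) (toX a (frame g y))
        (c (frame g y)) (d (frame g y)) := by
  have hb : base (rotField 2 a (frame g y)) = (row g a, 0) := by
    simp [base_apply, rotField_apply, frame]
  rw [lieD_comp hs c d _ (frame_mem g y), hb]
  have h1 := hc.bil_rot hσ hd g y a
  have h2 := hd.bil_rot hσ hc g y a
  rw [bil_swap, neg_eq_zero] at h2
  simp only [base_apply, frame] at h1 h2 ⊢
  rw [h1, h2, add_zero, add_zero]
  rfl

theorem lieD_trans_comp (hs : IsSmooth σ) {c d : N →L[ℝ] E}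
    (hc : IsFrameVector c) (hd : IsFrameVector d) (a : Fin 3) (g : G) (y : V) :
    lieD (transField a) (comp σ c d) (frame g y) =
      fderiv ℝ (fun q => bil (pull σ 0 q)) (row g 2, y) (toY a (frame g y))
        (c (frame g y)) (d (frame g y)) := by
  have h0 : ∀ {c : N →L[ℝ] E}, IsFrameVector c → c (transField a (frame g y)) = 0 := by
    intro c hc
    cases hc <;> rfl
  rw [lieD_comp hs c d _ (frame_mem g y), h0 hc, h0 hd]
  simp only [map_zero, zero_apply, add_zero]
  rfl

theorem closed_relation_frame (hσ : σ ∈ HM) {a b c : N →L[ℝ] E} (ha : IsFrameVector a)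
    (hb : IsFrameVector b) (hc : IsFrameVector c) (g : G) (y : V) :
    fderiv ℝ (fun q => bil (pull σ 0 q)) (row g 2, y) (a (frame g y)) (b (frame g y))
      (c (frame g y)) -
    fderiv ℝ (fun q => bil (pull σ 0 q)) (row g 2, y) (b (frame g y)) (a (frame g y))
      (c (frame g y)) +
    fderiv ℝ (fun q => bil (pull σ 0 q)) (row g 2, y) (c (frame g y)) (a (frame g y))
      (b (frame g y)) = 0 := by
  obtain ⟨u, hu, hu'⟩ := ha.exists_incl g y
  obtain ⟨v, hv, hv'⟩ := hb.exists_incl g y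
  obtain ⟨w, hw, hw'⟩ := hc.exists_incl g y
  rw [hu, hv, hw]
  exact closed_relation hσ g y ![u, v, w] (by intro i; fin_cases i <;> assumption)

/-- The components of a form in `ℋ_M` satisfy the first order system. -/
theorem isSystem_of_mem_HM (hσ : σ ∈ HM) :
    IsSystem (comp σ (toY 0) (toY 1)) (comp σ (toX 0) (toY 0)) (comp σ (toX 0) (toY 1)) := by
  have hs : IsSmooth σ := hσ.1.1
  have hh : IsHorizontal σ := hσ.1.2.1
  have x0 : IsFrameVector (toX 0) := .x (by decide)
  have x1 : IsFrameVector (toX 1) := .x (by decide)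
  have y0 : IsFrameVector (toY 0) := .y (by decide)
  have y1 : IsFrameVector (toY 1) := .y (by decide)
  have T : ∀ a, IsTangent (transField a) := fun a => .trans a
  have R0 : IsTangent (rotField 2 0) := .rot (by decide)
  have R1 : IsTangent (rotField 2 1) := .rot (by decide)
  have asd := fun g y => asd_relations hσ.1 g (torOf y)
  have ef : ∀ g y, comp σ (toX 0) (toX 1) (frame g y) = comp σ (toY 0) (toY 1) (frame g y) :=
    fun g y => (bil_pull σ g y (vecA g _ 0) (vecA g _ 1)).trans
      ((asd g y).1.trans (bil_pull σ g y (vecB g _ 0) (vecB g _ 1)).symm)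
  have ep : ∀ g y, comp σ (toX 1) (toY 1) (frame g y) = (-comp σ (toX 0) (toY 0)) (frame g y) :=
    fun g y => (bil_pull σ g y (vecA g _ 1) (vecB g _ 1)).trans
      ((asd g y).2.1.trans (congrArg Neg.neg (bil_pull σ g y (vecA g _ 0) (vecB g _ 0)).symm))
  have er : ∀ g y, comp σ (toX 1) (toY 0) (frame g y) = comp σ (toX 0) (toY 1) (frame g y) :=
    fun g y => (bil_pull σ g y (vecA g _ 1) (vecB g _ 0)).trans
      ((asd g y).2.2.trans (bil_pull σ g y (vecA g _ 0) (vecB g _ 1)).symm)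
  have gf := y0.isGood_comp hs y1
  have gp := x0.isGood_comp hs y0
  have gr := x0.isGood_comp hs y1
  have gf' := x0.isGood_comp hs x1
  have gp' := x1.isGood_comp hs y1
  have gr' := x1.isGood_comp hs y0
  have h01 : ∀ n, base (rotField 0 1 n) = 0 := fun n => by simp [base_apply, rotField_apply]
  refine ⟨gf, gp, gr, fun g y => ?_, fun g y => ?_, fun g y => ?_, fun g y => ?_, fun g y => ?_,
    fun g y => ?_⟩
  -- The first four equations are d_H σ = 0 on (A₀,A₁,B₀), (A₀,A₁,B₁), (A₀,B₀,B₁), (A₁,B₀,B₁),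
  -- rewritten through the anti-self-duality relations.
  · have c := closed_relation_frame hσ x0 x1 y0 g y
    rw [← lieD_congr gf' gf (T 0) ef, ← lieD_congr gr' gr R0 er, lieD_trans_comp hs x0 x1,
      lieD_rot_comp hs hh x0 y0, lieD_rot_comp hs hh x1 y0]
    linarith
  · have c := closed_relation_frame hσ x0 x1 y1 g y
    have hp := lieD_congr gp' gp.neg R0 ep g y
    rw [lieD_neg, lieD_rot_comp hs hh x1 y1] at hp
    rw [← lieD_congr gf' gf (T 1) ef, lieD_trans_comp hs x0 x1, lieD_rot_comp hs hh x0 y1]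
    linarith
  · have c := closed_relation_frame hσ x0 y0 y1 g y
    rw [lieD_rot_comp hs hh y0 y1, lieD_trans_comp hs x0 y1, lieD_trans_comp hs x0 y0]
    linarith
  · have c := closed_relation_frame hσ x1 y0 y1 g y
    have hp := lieD_congr gp' gp.neg (T 0) ep g y
    rw [lieD_neg, lieD_trans_comp hs x1 y1] at hp
    rw [← lieD_congr gr' gr (T 1) er, lieD_rot_comp hs hh y0 y1, lieD_trans_comp hs x1 y0]
    linarith
  -- Z fixes the base point, so only the frame vectors vary: Zp = σ(A₁,B₀) + σ(A₀,B₁), and below Zr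
  -- = σ(A₁,B₁) - σ(A₀,B₀).
  · have e := er g y
    have h := lieD_comp hs (toX 0) (toY 0) (rotField 0 1) (frame_mem g y)
    rw [h01, map_zero, zero_apply, zero_apply, zero_add] at h
    have h' : lieD (rotField 0 1) (comp σ (toX 0) (toY 0)) (frame g y) =
        comp σ (toX 1) (toY 0) (frame g y) + comp σ (toX 0) (toY 1) (frame g y) := h
    linarith
  · have e := ep g y
    rw [Pi.neg_apply] at e
    have h := lieD_comp hs (toX 0) (toY 1) (rotField 0 1) (frame_mem g y)
    rw [h01, map_zero, zero_apply, zero_apply, zero_add] at h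
    have hY : toY 1 (rotField 0 1 (frame g y)) = -toY 0 (frame g y) := by
      simp [toY_apply, rotField_apply]
    rw [hY, map_neg] at h
    have h' : lieD (rotField 0 1) (comp σ (toX 0) (toY 1)) (frame g y) =
        comp σ (toX 1) (toY 1) (frame g y) + -comp σ (toX 0) (toY 0) (frame g y) := h
    linarith

end Components

/-! ### The main theorem -/

/-- Over every point of M lies a frame at which f has its value at the standard frame, here zero; p
and r vanish there too, and the anti-self-duality relations give the other components. -/
theorem eq_zero_of_mem_HM {σ : Form 2} (hσ : σ ∈ HM)
    (h0 : comp σ (toY 0) (toY 1) (frame 1 0) = 0) : σ = 0 := by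
  have S := isSystem_of_mem_HM hσ
  funext p
  obtain ⟨s, t, hx⟩ := exists_frame_of_norm_eq_one (norm_point p)
  obtain ⟨y, hy⟩ := isOpenQuotientMap_torOf.surjective p.2
  have hf := (S.f_rot s t y).trans h0
  set g := rotG (show (2 : Fin 3) ≠ 0 by decide) s *
    (rotG (show (0 : Fin 3) ≠ 1 by decide) t * 1)
  have hp : framePt g (torOf y) = p := Prod.ext (Subtype.ext hx) hy
  rw [← hp]
  obtain ⟨hp0, hr0⟩ := S.p_r_eq_zero g y
  have asd := asd_relations hσ.1 g (torOf y)
  have f0 := (bil_pull σ g y (vecB g _ 0) (vecB g _ 1)).symm.trans hf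
  have p0 := (bil_pull σ g y (vecA g _ 0) (vecB g _ 0)).symm.trans hp0
  have r0 := (bil_pull σ g y (vecA g _ 0) (vecB g _ 1)).symm.trans hr0
  exact eq_zero_of_frame hσ.1.2.1 g (torOf y) (asd.1.trans f0) f0 p0 r0 (asd.2.2.trans r0)
    (asd.2.1.trans (by rw [p0, neg_zero]))

theorem comp_gamma_one : comp gamma (toY 0) (toY 1) (frame 1 0) = 1 := by
  rw [comp, bil_apply, pull_gamma 0 _ (row_ne_zero 1 2)]
  have h : ‖(base (frame 1 0)).1‖ = 1 := norm_row 1 2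
  rw [h]
  simp [trip, toY_apply, base_apply, frame]

theorem comp_sub_smul (σ τ : Form 2) (c : ℝ) (a b : N →L[ℝ] E) (n : N) :
    comp (σ - c • τ) a b n = comp σ a b n - c * comp τ a b n := by
  have : σ - c • τ = σ + (-c) • τ := by module
  rw [this, comp, pull_add, pull_smul]
  simp [comp, sub_eq_add_neg]

theorem HM_eq_span : HM = Submodule.span ℝ {gamma} := by
  refine le_antisymm (fun σ hσ => ?_) ?_
  · refine Submodule.mem_span_singleton.2 ⟨comp σ (toY 0) (toY 1) (frame 1 0), ?_⟩
    refine (sub_eq_zero.1 (eq_zero_of_mem_HM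
      (HM.sub_mem hσ (HM.smul_mem (comp σ (toY 0) (toY 1) (frame 1 0)) gamma_mem_HM)) ?_)).symm
    rw [comp_sub_smul, comp_gamma_one, mul_one, sub_self]
  · rw [Submodule.span_singleton_le_iff_mem]
    exact gamma_mem_HM

theorem gamma_ne_zero : gamma ≠ 0 := by
  intro h
  have := comp_gamma_one
  rw [h, comp, pull_zero] at this
  simp at this

end CYBoundary

end

theorem mainTheorem7 :
    Module.finrank ℝ CYBoundary.HM = 1 ∧
      CYBoundary.HM = Submodule.span ℝ {CYBoundary.gamma} ∧
      CYBoundary.IsSO3Invariant CYBoundary.gamma := by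
  refine ⟨?_, CYBoundary.HM_eq_span, CYBoundary.isSO3Invariant_gamma⟩
  rw [CYBoundary.HM_eq_span]
  exact finrank_span_singleton CYBoundary.gamma_ne_zero
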